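/- **Model.** A typical IoT device sits at the origin of $\mathbb R^2$ and sends its message $N\ge 1$ times. Base stations (BSs), located at the points $X_j$ of a homogeneous Poisson point process (HPPP) $\Phi_{\mathrm B}$ of density $\lambda_{\mathrm B}\ge 0$, all listen to all $M\ge1$ multiplexing bands of bandwidth $B$ ($M=1$: single-band protocol, $M>1$: benchmark protocol). Path loss is $r^{-\alpha}$ with $\alpha>2$. The SINR of the $i$-th message ($1\le i\le N$) at the BS $X_j$ is $$\mathrm{SINR}_{i,j}=\frac{h_{i,j}\,|X_j|^{-\alpha}}{\hat P_N+\sum_{Y\in\tilde\Phi_{\mathrm{IoT}}} f_Y\,|Y-X_j|^{-\alpha}+\hat P_{\mathrm I}\sum_{Z\in\tilde\Phi_{\mathrm I}} f_Z\,|Z-X_j|^{-\alpha}},$$ where all gains $h,f$ are independent $\mathrm{Exp}(1)$ variables, $\hat P_N\ge0$ is the noise power divided by the IoT transmit power $P_{\mathrm{IoT}}$, $\hat P_{\mathrm I}=\frac{P_{\mathrm I}\,b/B_{\mathrm I}}{P_{\mathrm{IoT}}}$ (with $P_{\mathrm I},B_{\mathrm I}$ the power and bandwidth of an incumbent and $b$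 the bandwidth of an IoT signal), and the interfering IoT devices $\tilde\Phi_{\mathrm{IoT}}$ and interfering incumbents $\tilde\Phi_{\mathrm I}$ are HPPPs of densities $$\tilde\lambda_{\mathrm{IoT}}=N\beta_T\lambda_{\mathrm T}\frac{\beta_F b}{MB}\lambda_{\mathrm{IoT}},\qquad \tilde\lambda_{\mathrm I}=\min\Big\{1,\frac{B_{\mathrm I}}{MB}\Big\}\lambda_{\mathrm I},$$ where $\lambda_{\mathrm{IoT}},\lambda_{\mathrm I}\ge0$ (not both zero) are the densities of IoT devices and incumbents, $\lambda_{\mathrm T}=t/T$ with $t,T>0$ the message duration and the period between messages, and $\beta_T,\beta_F\in[1,2]$. The interference is independent from BS to BS. Each message meets an independent set of incumbents with independent gains. Under *random repetition* each message also meets an independent set of interfering IoT devices with independent gains; under *PN repetition* all $N$ messages meet, at a given BS, the same interfering IoT devices with the same gains. All these random objects are otherwise mutually independent. Without BS association, the success probability $\mathbb P_s$ is the probability that $\mathrm{SINR}_{i,j}>\tau$ for some message $i$ and some BS $j$, where $\tau>0$. Put $\delta=2/\alpha$ and $\xi=\frac{\sin(\pi\delta)}{\pi\delta}$. **Theorem.**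 1. For every $\hat P_N\ge0$ and both schemes, $\mathbb P_s=1-\mathbb E_{\Phi_{\mathrm B}}\big[\prod_{X_j\in\Phi_{\mathrm B}}\mathbb Q_j\big]$, where $\mathbb Q_j$ is the probability, given the location of BS $j$, that $\max_{1\le i\le N}\mathrm{SINR}_{i,j}\le\tau$. 2. Under PN repetition, as $\hat P_N\to0^+$, $\mathbb P_s$ converges to $$\mathbb P_s^{\mathrm{B,PN}}=1-\exp\left(\xi\tau^{-\delta}\sum_{k=1}^N\binom Nk\frac{(-1)^k\lambda_{\mathrm B}}{k^\delta\tilde\lambda_{\mathrm{IoT}}+k\hat P_{\mathrm I}^\delta\tilde\lambda_{\mathrm I}}\right),$$ and equals it when $\hat P_N=0$. 3. Under random repetition, as $\hat P_N\to0^+$, $\mathbb P_s$ converges to $$\mathbb P_s^{\mathrm{B,R}}=1-\exp\left(-\xi\tau^{-\delta}H_N\frac{\lambda_{\mathrm B}}{\tilde\lambda_{\mathrm{IoT}}+\hat P_{\mathrm I}^\delta\tilde\lambda_{\mathrm I}}\right),$$ and equals it when $\hat P_N=0$; here $H_N=\sum_{k=1}^N\frac1k=-\sum_{k=1}^N\binom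 Nk(-1)^kk^{-1}$ is the harmonic number. 4. For every $\hat P_N\ge0$, the success probability under PN repetition is at most the success probability under random repetition. -/

import Mathlib

open MeasureTheory ProbabilityTheory
open scoped ENNReal NNReal

noncomputable section

namespace UNB

/-- The Euclidean plane. -/
abbrev Plane : Type := EuclideanSpace ℝ (Fin 2)

/-- A finite or countably infinite enumerated point configuration `(n, y)` in the plane:
its points are the `y u` with `u < n`, where `n` may be infinite. -/
abbrev Config : Type := ℕ∞ × (ℕ → Plane)

/-- The number of points of the configuration `c` in the set `A`. -/
def Config.count (c : Config) (A : Set Plane) : ℕ∞ :=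
  {u : ℕ | (u : ℕ∞) < c.1 ∧ c.2 u ∈ A}.encard

/-- `Φ` is a homogeneous Poisson point process of density `l` in the plane: the number of points
in a Borel set of finite area is Poisson with mean `l` times the area, and the numbers of points in
pairwise disjoint such sets are independent. -/
structure IsHPPP {Ω : Type*} [MeasurableSpace Ω] (P : Measure Ω) (Φ : Ω → Config) (l : ℝ≥0) :
    Prop where
  measurable : Measurable Φ
  law_count : ∀ A : Set Plane, MeasurableSet A → volume A < ∞ →
    P.map (fun ω => (Φ ω).count A)
      = (poissonMeasure (l * (volume A).toNNReal)).map (fun n : ℕ => (n : ℕ∞))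
  indep_count : ∀ (m : ℕ) (A : Fin m → Set Plane), (∀ k, MeasurableSet (A k)) →
    (∀ k, volume (A k) < ∞) → Pairwise (fun k l => Disjoint (A k) (A l)) →
    iIndepFun (fun k ω => (Φ ω).count (A k)) P

/-- The deterministic parameters of the network. -/
structure Params where
  /-- number of repetitions of each message -/
  N : ℕ
  /-- number of multiplexing bands (`M = 1`: single-band protocol) -/
  M : ℕ
  /-- path-loss exponent -/
  α : ℝ
  /-- SINR decoding threshold -/
  τ : ℝ
  /-- bandwidth of one multiplexing band -/
  B : ℝ
  /-- bandwidth of an IoT signal -/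
  b : ℝ
  /-- bandwidth of an incumbent signal -/
  BI : ℝ
  /-- transmit power of an IoT device -/
  PIoT : ℝ
  /-- transmit power of an incumbent -/
  PI : ℝ
  /-- duration of one message -/
  t : ℝ
  /-- period between two messages -/
  T : ℝ
  /-- time-synchronization factor (1 slotted, 2 unslotted) -/
  βT : ℝ
  /-- frequency-synchronization factor (1 slotted, 2 unslotted) -/
  βF : ℝ
  /-- density of the base stations -/
  lamB : ℝ
  /-- density of the IoT devices -/
  lamIoT : ℝ
  /-- density of the incumbents -/
  lamI : ℝ
  one_le_N : 1 ≤ N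
  one_le_M : 1 ≤ M
  two_lt_α : 2 < α
  τ_pos : 0 < τ
  B_pos : 0 < B
  b_pos : 0 < b
  BI_pos : 0 < BI
  PIoT_pos : 0 < PIoT
  PI_pos : 0 < PI
  t_pos : 0 < t
  T_pos : 0 < T
  one_le_βT : 1 ≤ βT
  βT_le_two : βT ≤ 2
  one_le_βF : 1 ≤ βF
  βF_le_two : βF ≤ 2
  lamB_nonneg : 0 ≤ lamB
  lamIoT_nonneg : 0 ≤ lamIoT
  lamI_nonneg : 0 ≤ lamI
  /-- there is some interference -/
  lam_pos : 0 < lamIoT + lamI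

namespace Params

variable (p : Params)

/-- Traffic intensity `λ_T = t / T`. -/
def lamT : ℝ := p.t / p.T

/-- Normalized in-band power of an incumbent, `(P_I b / B_I) / P_IoT`. -/
def PIhat : ℝ := p.PI * p.b / p.BI / p.PIoT

/-- Density of the interfering IoT devices. -/
def lamIoTtilde : ℝ := p.N * p.βT * p.lamT * (p.βF * p.b / (p.M * p.B)) * p.lamIoT

/-- Density of the interfering incumbents. -/
def lamItilde : ℝ := min 1 (p.BI / (p.M * p.B)) * p.lamI

/-- `δ = 2 / α`. -/
def δ : ℝ := 2 / p.α

/-- `ξ = sin(πδ) / (δπ)`. -/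
def ξ : ℝ := Real.sin (Real.pi * p.δ) / (p.δ * Real.pi)

end Params

/-- The two repetition schemes. -/
inductive Repetition
  | pn
  | random

/-- Which interferer set (out of `N` independent ones at each base station) message `i` meets: under
PN repetition the same one for all messages, under random repetition a fresh one for each. -/
def Repetition.pick {N : ℕ} : Repetition → Fin N → Fin N
  | .pn, i => ⟨0, i.pos⟩
  | .random, i => i

/-- Labels of the elementary random inputs of the model. -/
inductive Source (N : ℕ)
  | bs
  | signal (i : Fin N) (j : ℕ)
  | iot (i : Fin N) (j : ℕ)
  | iotFading (i : Fin N) (j u : ℕ)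
  | inc (i : Fin N) (j : ℕ)
  | incFading (i : Fin N) (j u : ℕ)

/-- The random network, seen from a typical device at the origin. Base stations are numbered by `j`,
messages by `i`, interferers by `u`. -/
structure Network (p : Params) {Ω : Type*} [MeasurableSpace Ω] (P : Measure Ω) where
  /-- the base stations -/
  bs : Ω → Config
  /-- channel gain of message `i` at base station `j` -/
  h : Fin p.N → ℕ → Ω → ℝ
  /-- `i`-th set of interfering IoT devices affecting base station `j` -/
  iot : Fin p.N → ℕ → Ω → Config
  /-- channel gains of these devices -/
  fIoT : Fin p.N → ℕ → ℕ → Ω → ℝ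
  /-- incumbents interfering with message `i` at base station `j` -/
  inc : Fin p.N → ℕ → Ω → Config
  /-- channel gains of these incumbents -/
  fInc : Fin p.N → ℕ → ℕ → Ω → ℝ
  bs_hppp : IsHPPP P bs p.lamB.toNNReal
  iot_hppp : ∀ i j, IsHPPP P (iot i j) p.lamIoTtilde.toNNReal
  inc_hppp : ∀ i j, IsHPPP P (inc i j) p.lamItilde.toNNReal
  h_measurable : ∀ i j, Measurable (h i j)
  fIoT_measurable : ∀ i j u, Measurable (fIoT i j u)
  fInc_measurable : ∀ i j u, Measurable (fInc i j u)
  h_law : ∀ i j, HasLaw (h i j) (expMeasure 1) P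
  fIoT_law : ∀ i j u, HasLaw (fIoT i j u) (expMeasure 1) P
  fInc_law : ∀ i j u, HasLaw (fInc i j u) (expMeasure 1) P
  /-- all these random inputs are mutually independent -/
  indep : iIndep (fun s : Source p.N => match s with
    | .bs => MeasurableSpace.comap bs inferInstance
    | .signal i j => MeasurableSpace.comap (h i j) inferInstance
    | .iot i j => MeasurableSpace.comap (iot i j) inferInstance
    | .iotFading i j u => MeasurableSpace.comap (fIoT i j u) inferInstance
    | .inc i j => MeasurableSpace.comap (inc i j) inferInstance
    | .incFading i j u => MeasurableSpace.comap (fInc i j u) inferInstance) P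

/-- Power received at `x`, under path loss with exponent `α`, from unit-power transmitters at the
points of `c` with channel gains `f`. -/
def received (α : ℝ) (c : Config) (f : ℕ → ℝ) (x : Plane) : ℝ≥0∞ :=
  ∑' u : {u : ℕ // (u : ℕ∞) < c.1}, ENNReal.ofReal (f u) * ENNReal.ofReal (dist (c.2 u) x) ^ (-α)

namespace Network

variable {p : Params} {Ω : Type*} [MeasurableSpace Ω] {P : Measure Ω}

/-- SINR of message `i` at base station `j`, if that station is at `x`; `n` is the normalized noise
power `P_N / P_IoT`. -/
def sinr (W : Network p P) (s : Repetition) (n : ℝ) (i : Fin p.N) (j : ℕ) (x : Plane) (ω : Ω) :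
    ℝ≥0∞ :=
  ENNReal.ofReal (W.h i j ω) * ENNReal.ofReal ‖x‖ ^ (-p.α) /
    (ENNReal.ofReal n
      + received p.α (W.iot (s.pick i) j ω) (fun u => W.fIoT (s.pick i) j u ω) x
      + ENNReal.ofReal p.PIhat * received p.α (W.inc i j ω) (fun u => W.fInc i j u ω) x)

/-- Success probability without BS association: at least one base station decodes at least one of
the `N` messages. -/
def successProb (W : Network p P) (s : Repetition) (n : ℝ) : ℝ :=
  P.real {ω | ∃ j : ℕ, (j : ℕ∞) < (W.bs ω).1 ∧
    ∃ i : Fin p.N, ENNReal.ofReal p.τ < W.sinr s n i j ((W.bs ω).2 j) ω}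

/-- Probability that base station `j`, if located at `x`, decodes none of the `N` messages. -/
def failProb (W : Network p P) (s : Repetition) (n : ℝ) (j : ℕ) (x : Plane) : ℝ :=
  P.real {ω | (⨆ i : Fin p.N, W.sinr s n i j x ω) ≤ ENNReal.ofReal p.τ}

end Network

/-- Closed form for PN repetition. -/
def closedPN (p : Params) : ℝ :=
  1 - Real.exp (p.ξ * p.τ ^ (-p.δ) * ∑ k ∈ Finset.Icc 1 p.N,
    (p.N.choose k : ℝ) * ((-1) ^ k * p.lamB /
      ((k : ℝ) ^ p.δ * p.lamIoTtilde + k * p.PIhat ^ p.δ * p.lamItilde)))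

/-- Closed form for random repetition. -/
def closedRandom (p : Params) : ℝ :=
  1 - Real.exp (-(p.ξ * p.τ ^ (-p.δ) * (harmonic p.N : ℝ) *
    (p.lamB / (p.lamIoTtilde + p.PIhat ^ p.δ * p.lamItilde))))

end UNB

end

/-! Fix a station at `x ≠ 0` and put `σ = τ‖x‖^α`. Because the signal gain is exponential, a message
fails with conditional probability `1 - exp(-σD)`, where `D` is noise plus interference, and
`exp(-σD)` factors into noise, device and incumbent terms. Let `X` be the device factor and `c` the
noise factor times the mean incumbent factor. Averaging over the incumbents, and under random
repetition over the devices as well, gives failure probability `E[(1 - cX)^N]` for PN repetition,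
where all messages share `X`, and `(1 - c E[X])^N` for random repetition. Jensen's inequality
compares the two (`one_sub_mul_lintegral_pow_le`).

The Laplace functional of a Poisson process (`IsHPPP.lintegral_expNeg_total`) and a planar integral
(`lintegral_pathLoss`) show that interference of density `l` has Laplace transform `exp(-l (π/ξ)
s^δ)`. Since `αδ = 2`, this is Gaussian in `‖x‖` at `s = σ`. In the binomial expansion, `E[X^k]` is
the transform at `kσ`, whence the factor `k^δ` for shared devices, while `k` independent fields
contribute a factor `k`: this is `Params.rate`, and `toReal_measure_fail` is the resulting formula.

Stations carry independent marks that are also independent of their locations, so the probability of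
total failure is the mean of the product of the failure probabilities. The Laplace functional, now
of the stations and with test function `-log failAt`, turns this into `exp(-λ_B ∫ (1 - failAt))`.
The `k = 0` term of the expansion cancels the `1`. Without noise the other terms are Gaussian
integrals giving the closed forms; dominated convergence gives the limits.

Working in `[0, ∞]` with `expNeg` and `negLog` covers infinite interference and zero failure
probability without separate cases. -/

noncomputable section

namespace UNB

open Filter Topology

/-! ### Exponential and logarithm on `[0, ∞]`. -/

/-- The function `x ↦ exp (-x)` on `[0, ∞]`. -/
def expNeg (x : ℝ≥0∞) : ℝ≥0∞ := EReal.exp (-(x : EReal))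

/-- The function `y ↦ -log y` from `[0, 1]` to `[0, ∞]`. -/
def negLog (y : ℝ≥0∞) : ℝ≥0∞ := (-ENNReal.log y).toENNReal

@[simp] lemma expNeg_zero : expNeg 0 = 1 := by simp [expNeg]

@[simp] lemma expNeg_top : expNeg ⊤ = 0 := by simp [expNeg]

lemma expNeg_ofReal {x : ℝ} (hx : 0 ≤ x) :
    expNeg (ENNReal.ofReal x) = ENNReal.ofReal (Real.exp (-x)) := by
  rw [expNeg, EReal.coe_ennreal_ofReal, max_eq_left hx, ← EReal.coe_neg, EReal.exp_coe]

lemma expNeg_eq {x : ℝ≥0∞} (hx : x ≠ ⊤) :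
    expNeg x = ENNReal.ofReal (Real.exp (-x.toReal)) := by
  conv_lhs => rw [← ENNReal.ofReal_toReal hx]
  exact expNeg_ofReal ENNReal.toReal_nonneg

lemma toReal_expNeg {x : ℝ≥0∞} (hx : x ≠ ⊤) : (expNeg x).toReal = Real.exp (-x.toReal) := by
  rw [expNeg_eq hx, ENNReal.toReal_ofReal (Real.exp_pos _).le]

lemma continuous_expNeg : Continuous expNeg :=
  ENNReal.continuous_exp.comp (continuous_neg.comp continuous_coe_ennreal_ereal)

@[fun_prop]
lemma measurable_expNeg : Measurable expNeg := continuous_expNeg.measurable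

lemma expNeg_antitone : Antitone expNeg := fun x y h => by
  simp only [expNeg, EReal.exp_le_exp_iff, EReal.neg_le_neg_iff]
  exact_mod_cast h

lemma expNeg_le_one (x : ℝ≥0∞) : expNeg x ≤ 1 := by
  simpa using expNeg_antitone (zero_le (a := x))

lemma expNeg_ne_top (x : ℝ≥0∞) : expNeg x ≠ ⊤ := ne_top_of_le_ne_top ENNReal.one_ne_top (expNeg_le_one x)

lemma expNeg_add (x y : ℝ≥0∞) : expNeg (x + y) = expNeg x * expNeg y := by
  rw [expNeg, EReal.coe_ennreal_add, EReal.neg_add (by simp) (by simp), sub_eq_add_neg,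
    EReal.exp_add, expNeg, expNeg]

lemma expNeg_sum {ι : Type*} (s : Finset ι) (a : ι → ℝ≥0∞) :
    expNeg (∑ i ∈ s, a i) = ∏ i ∈ s, expNeg (a i) := by
  classical
  induction s using Finset.induction_on with
  | empty => simp
  | insert i s hi ih => rw [Finset.sum_insert hi, Finset.prod_insert hi, expNeg_add, ih]

lemma expNeg_mul_natCast (c : ℝ≥0∞) (n : ℕ) : expNeg (c * n) = expNeg c ^ n := by
  have := expNeg_sum (Finset.range n) (fun _ => c)
  simpa [mul_comm] using this

lemma expNeg_negLog {y : ℝ≥0∞} (hy : y ≤ 1) : expNeg (negLog y) = y := by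
  rw [expNeg, negLog, EReal.coe_toENNReal, neg_neg, ENNReal.exp_log]
  rw [EReal.neg_nonneg, ENNReal.log_le_zero_iff]
  exact hy

@[simp] lemma negLog_one : negLog 1 = 0 := by simp [negLog]

@[fun_prop]
lemma measurable_negLog : Measurable negLog := by
  unfold negLog
  exact (ENNReal.measurable_log.neg).ereal_toENNReal

lemma tendsto_prod_expNeg (a : ℕ → ℝ≥0∞) :
    Tendsto (fun m => ∏ u ∈ Finset.range m, expNeg (a u)) atTop (𝓝 (expNeg (∑' u, a u))) := by
  simp_rw [← expNeg_sum]
  exact (continuous_expNeg.tendsto _).comp (ENNReal.summable.hasSum.tendsto_sum_nat)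

/-! ### Laplace functional of a Poisson point process. -/

section

/-- This is the Poisson generating function at `q = exp(-c)`; `c = ∞` gives `q = 0`, the void
probability. -/
lemma lintegral_poissonMeasure_expNeg (m : ℝ≥0) (c : ℝ≥0∞) :
    ∫⁻ n, expNeg (c * (n : ℝ≥0∞)) ∂(poissonMeasure m) = expNeg (m * (1 - expNeg c)) := by
  set q : ℝ := (expNeg c).toReal with hq
  have hqc : expNeg c = ENNReal.ofReal q := (ENNReal.ofReal_toReal (expNeg_ne_top c)).symm
  have hq0 : 0 ≤ q := ENNReal.toReal_nonneg
  have hq1 : q ≤ 1 := ENNReal.toReal_le_of_le_ofReal zero_le_one (by simpa using expNeg_le_one c)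
  have hs : HasSum (fun n : ℕ => Real.exp (-m) * (m * q) ^ n / (n.factorial : ℝ))
      (Real.exp (-m) * Real.exp (m * q)) := by
    simp_rw [mul_div_assoc]
    rw [Real.exp_eq_exp_ℝ]
    exact (NormedSpace.expSeries_div_hasSum_exp ((m : ℝ) * q)).mul_left _
  have hr : (m : ℝ≥0∞) * (1 - expNeg c) = ENNReal.ofReal (m * (1 - q)) := by
    rw [hqc, ENNReal.ofReal_mul m.coe_nonneg, ENNReal.ofReal_sub _ hq0]; simp
  rw [hr, expNeg_ofReal (mul_nonneg m.coe_nonneg (by linarith)), poissonMeasure,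
    lintegral_sum_measure]
  simp_rw [lintegral_smul_measure, lintegral_dirac, expNeg_mul_natCast, hqc, smul_eq_mul]
  rw [show Real.exp (-(m * (1 - q))) = Real.exp (-m) * Real.exp (m * q) by
    rw [← Real.exp_add]; ring_nf]
  rw [← hs.tsum_eq, ENNReal.ofReal_tsum_of_nonneg (fun n => by positivity) hs.summable]
  congr 1 with n
  rw [← ENNReal.ofReal_pow hq0, ← ENNReal.ofReal_mul (by positivity)]
  congr 1
  rw [mul_pow]; ring

/-- Sum of `g` over the points of the configuration `c`. -/
def Config.total (c : Config) (g : Plane → ℝ≥0∞) : ℝ≥0∞ :=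
  ∑' u : {u : ℕ // (u : ℕ∞) < c.1}, g (c.2 u)

lemma Config.total_eq (c : Config) (g : Plane → ℝ≥0∞) :
    c.total g = ∑' u : ℕ, if (u : ℕ∞) < c.1 then g (c.2 u) else 0 := by
  rw [Config.total]
  refine (tsum_subtype {u : ℕ | (u : ℕ∞) < c.1} (fun u => g (c.2 u))).trans ?_
  exact tsum_congr fun u => by simp [Set.indicator_apply]

lemma measurableSet_lt_config (u : ℕ) : MeasurableSet {c : Config | (u : ℕ∞) < c.1} :=
  measurable_fst (MeasurableSet.of_discrete (s := {n : ℕ∞ | (u : ℕ∞) < n}))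

lemma measurable_total {g : Plane → ℝ≥0∞} (hg : Measurable g) :
    Measurable fun c : Config => c.total g := by
  simp_rw [Config.total_eq]
  refine Measurable.tsum fun u => Measurable.ite (measurableSet_lt_config u) ?_ measurable_const
  fun_prop

lemma Config.coe_count (c : Config) (A : Set Plane) :
    ((c.count A : ℕ∞) : ℝ≥0∞) = c.total (A.indicator 1) := by
  rw [Config.total_eq, Config.count, ← ENNReal.tsum_set_one, tsum_subtype _ (fun _ => (1 : ℝ≥0∞))]
  congr 1 with u
  by_cases h : (u : ℕ∞) < c.1 <;> by_cases h' : c.2 u ∈ A <;> simp [Set.indicator, h, h']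

variable {Ω : Type*} [MeasurableSpace Ω] {P : Measure Ω}
  {Φ : Ω → Config} {l : ℝ≥0}

lemma IsHPPP.lintegral_expNeg_count (h : IsHPPP P Φ l) {A : Set Plane} (hA : MeasurableSet A)
    (hA' : volume A < ∞) (c : ℝ≥0∞) :
    ∫⁻ ω, expNeg (c * (((Φ ω).count A : ℕ∞) : ℝ≥0∞)) ∂P
      = expNeg (l * (volume A * (1 - expNeg c))) := by
  have hl := h.law_count A hA hA'
  have hm : AEMeasurable (fun ω => (Φ ω).count A) P := by
    -- A count that is not a.e. measurable would have zero `map`, whereas its law is an image of a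
    -- Poisson probability measure.
    by_contra hcon
    rw [Measure.map_of_not_aemeasurable hcon] at hl
    have := Measure.isProbabilityMeasure_map (μ := poissonMeasure (l * (volume A).toNNReal))
      (f := fun n : ℕ => (n : ℕ∞)) AEMeasurable.of_discrete
    rw [← hl] at this
    exact this.ne_zero _ rfl
  have := lintegral_map' (μ := P) (f := fun n : ℕ∞ => expNeg (c * (n : ℝ≥0∞)))
    Measurable.of_discrete.aemeasurable hm
  rw [← this, hl, lintegral_map Measurable.of_discrete Measurable.of_discrete]
  simp only [ENat.toENNReal_coe]
  rw [lintegral_poissonMeasure_expNeg]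
  push_cast
  rw [ENNReal.coe_toNNReal hA'.ne, mul_assoc]

/-- The level sets of `f` inside `B` are disjoint and of finite area, so the total is a linear
combination of independent Poisson counts and its transform factorizes. -/
lemma IsHPPP.lintegral_expNeg_total_simple (h : IsHPPP P Φ l) (f : SimpleFunc Plane ℝ≥0∞)
    {B : Set Plane} (hB : MeasurableSet B) (hB' : volume B < ∞) :
    ∫⁻ ω, expNeg ((Φ ω).total (B.indicator f)) ∂P
      = expNeg (l * ∫⁻ y, (1 - expNeg (B.indicator f y))) := by
  classical
  set e := f.range.equivFin
  set v : Fin f.range.card → ℝ≥0∞ := fun k => (e.symm k : ℝ≥0∞)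
  set A : Fin f.range.card → Set Plane := fun k => f ⁻¹' {v k} ∩ B
  have hA : ∀ k, MeasurableSet (A k) := fun k => (f.measurableSet_preimage _).inter hB
  have hA' : ∀ k, volume (A k) < ∞ := fun k => (measure_mono Set.inter_subset_right).trans_lt hB'
  have hvinj : Function.Injective v := fun a b hab => e.symm.injective (Subtype.ext hab)
  have hdisj : Pairwise (fun k l => Disjoint (A k) (A l)) := by
    intro a b hab
    rw [Set.disjoint_left]
    rintro y ⟨hy, -⟩ ⟨hy', -⟩
    exact hab (hvinj (hy.symm.trans hy'))
  -- Used twice: with `F = id` for the total, and with `F x = 1 - expNeg x` for the integrand of the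
  -- exponent.
  have key : ∀ (F : ℝ≥0∞ → ℝ≥0∞), F 0 = 0 → ∀ y,
      F (B.indicator f y) = ∑ k, F (v k) * (A k).indicator 1 y := by
    intro F hF y
    by_cases hy : y ∈ B
    · rw [Finset.sum_eq_single (e ⟨f y, f.mem_range_self y⟩)]
      · simp [A, v, hy]
      · intro b _ hb
        have : y ∉ A b := by
          rintro ⟨h1, -⟩
          apply hb
          rw [← e.symm_apply_eq]
          exact Subtype.ext h1.symm
        simp [this]
      · simp
    · have : ∀ k, y ∉ A k := fun k hk => hy hk.2
      simp [hy, this, hF]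
  have htot : ∀ c : Config, c.total (B.indicator f) = ∑ k, v k * ((c.count (A k) : ℕ∞) : ℝ≥0∞) := by
    intro c
    simp_rw [Config.coe_count, Config.total, ← ENNReal.tsum_mul_left]
    rw [← Summable.tsum_finsetSum (fun _ _ => ENNReal.summable)]
    congr 1 with u
    exact key id rfl _
  simp_rw [htot, expNeg_sum]
  rw [lintegral_prod_eq_prod_lintegral_of_indepFun]
  · simp_rw [h.lintegral_expNeg_count (hA _) (hA' _), ← expNeg_sum, ← Finset.mul_sum]
    congr 2
    rw [lintegral_congr (fun y => key (fun x => 1 - expNeg x) (by simp) y),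
      lintegral_finsetSum _ (fun k _ => (measurable_one.indicator (hA k)).const_mul _)]
    refine Finset.sum_congr rfl fun k _ => ?_
    rw [lintegral_const_mul _ (measurable_one.indicator (hA k)), lintegral_indicator_one (hA k),
      mul_comm]
  · exact (h.indep_count _ A hA hA' hdisj).comp (fun k n => expNeg (v k * (n : ℝ≥0∞)))
      (fun k => Measurable.of_discrete)
  · intro k
    simp_rw [Config.coe_count]
    have := (measurable_total (measurable_one.indicator (hA k))).comp h.measurable
    exact measurable_expNeg.comp (this.const_mul _)

/-- Laplace functional of a homogeneous Poisson point process. -/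
theorem IsHPPP.lintegral_expNeg_total [IsProbabilityMeasure P] (h : IsHPPP P Φ l) {g : Plane → ℝ≥0∞} (hg : Measurable g) :
    ∫⁻ ω, expNeg ((Φ ω).total g) ∂P = expNeg (l * ∫⁻ y, (1 - expNeg (g y))) := by
  -- Cutting to balls is needed because level sets of the approximating simple functions may have
  -- infinite area, where `IsHPPP` prescribes no counts.
  set G : ℕ → Plane → ℝ≥0∞ := fun m =>
    (Metric.ball (0 : Plane) m).indicator (SimpleFunc.eapprox g m) with hG
  have hGm : ∀ m, Measurable (G m) := fun m =>
    (SimpleFunc.eapprox g m).measurable.indicator Metric.isOpen_ball.measurableSet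
  have hmono : Monotone G := by
    intro a b hab y
    refine (Set.indicator_le_indicator_of_subset
      (Metric.ball_subset_ball (Nat.cast_le.2 hab)) (fun _ => zero_le) y).trans ?_
    exact Set.indicator_le_indicator (SimpleFunc.monotone_eapprox g hab y)
  have hlim : ∀ y, Tendsto (fun m => G m y) atTop (𝓝 (g y)) := by
    intro y
    refine (SimpleFunc.tendsto_eapprox hg y).congr' ?_
    obtain ⟨m, hm⟩ := exists_nat_gt ‖y‖
    filter_upwards [eventually_ge_atTop m] with k hk
    have : y ∈ Metric.ball (0 : Plane) k := by
      rw [mem_ball_zero_iff]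
      exact hm.trans_le (by exact_mod_cast hk)
    simp [hG, this]
  have h1 : ∀ c : Config, Tendsto (fun m => c.total (G m)) atTop (𝓝 (c.total g)) := by
    intro c
    simp_rw [Config.total, ← lintegral_count]
    exact lintegral_tendsto_of_tendsto_of_monotone (fun m => Measurable.of_discrete.aemeasurable)
      (ae_of_all _ fun u a b hab => hmono hab _) (ae_of_all _ fun u => hlim _)
  have h2 : Tendsto (fun m => ∫⁻ ω, expNeg ((Φ ω).total (G m)) ∂P) atTop
      (𝓝 (∫⁻ ω, expNeg ((Φ ω).total g) ∂P)) := by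
    refine tendsto_lintegral_of_dominated_convergence (fun _ => 1)
      (fun m => measurable_expNeg.comp ((measurable_total (hGm m)).comp h.measurable))
      (fun m => ae_of_all _ fun ω => expNeg_le_one _) (by simp)
      (ae_of_all _ fun ω => (continuous_expNeg.tendsto _).comp (h1 _))
  have h3 : Tendsto (fun m => ∫⁻ y, (1 - expNeg (G m y))) atTop
      (𝓝 (∫⁻ y, (1 - expNeg (g y)))) := by
    refine lintegral_tendsto_of_tendsto_of_monotone
      (fun m => (measurable_const.sub (measurable_expNeg.comp (hGm m))).aemeasurable)
      (ae_of_all _ fun y a b hab => tsub_le_tsub_left (expNeg_antitone (hmono hab y)) _)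
      (ae_of_all _ fun y => ?_)
    exact ((ENNReal.continuous_sub_left ENNReal.one_ne_top).tendsto _).comp
      ((continuous_expNeg.tendsto _).comp (hlim y))
  refine tendsto_nhds_unique h2 ?_
  have h4 : ∀ m, ∫⁻ ω, expNeg ((Φ ω).total (G m)) ∂P = expNeg (l * ∫⁻ y, (1 - expNeg (G m y))) :=
    fun m => h.lintegral_expNeg_total_simple _ Metric.isOpen_ball.measurableSet
      measure_ball_lt_top
  simp_rw [h4]
  exact (continuous_expNeg.tendsto _).comp (ENNReal.Tendsto.const_mul h3 (Or.inr (by simp)))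

end

/-! ### Exponential gains: Laplace transform and distribution function. -/

section ExponentialLaw

instance : IsProbabilityMeasure (expMeasure 1) := isProbabilityMeasure_expMeasure one_pos

lemma lintegral_expMeasure_one {F : ℝ → ℝ≥0∞} (hF : Measurable F) :
    ∫⁻ x, F x ∂(expMeasure 1) = ∫⁻ x in Set.Ioi 0, ENNReal.ofReal (Real.exp (-x)) * F x := by
  have : expMeasure 1 = volume.withDensity (exponentialPDF 1) := rfl
  have hm : Measurable (exponentialPDF 1) := (measurable_exponentialPDFReal 1).ennreal_ofReal
  rw [this, lintegral_withDensity_eq_lintegral_mul _ hm hF,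
    restrict_Ioi_eq_restrict_Ici, ← lintegral_indicator measurableSet_Ici]
  refine lintegral_congr fun x => ?_
  by_cases hx : 0 ≤ x
  · simp [Set.indicator_of_mem (Set.mem_Ici.2 hx), exponentialPDF_of_nonneg hx]
  · simp [hx, exponentialPDF_of_neg (not_le.1 hx)]

lemma lintegral_expMeasure_expNeg (b : ℝ≥0∞) :
    ∫⁻ x, expNeg (ENNReal.ofReal x * b) ∂(expMeasure 1) = (1 + b)⁻¹ := by
  rw [lintegral_expMeasure_one (by fun_prop)]
  by_cases hb : b = ⊤
  · rw [hb, setLIntegral_congr_fun (g := fun _ => 0) measurableSet_Ioi]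
    · simp
    · intro x hx
      have hx' : ENNReal.ofReal x ≠ 0 := (ENNReal.ofReal_pos.2 hx).ne'
      simp [ENNReal.mul_top hx']
  · lift b to ℝ≥0 using hb
    rw [setLIntegral_congr_fun (g := fun x : ℝ => ENNReal.ofReal (Real.exp (-(1 + b) * x)))
      measurableSet_Ioi]
    · have hb : -(1 + (b : ℝ)) < 0 := by have := b.coe_nonneg; linarith
      rw [← ofReal_integral_eq_lintegral_ofReal (integrableOn_exp_mul_Ioi hb 0)
        (ae_of_all _ fun x => (Real.exp_pos _).le), integral_exp_mul_Ioi hb 0]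
      rw [mul_zero, Real.exp_zero, neg_div_neg_eq, one_div, ENNReal.ofReal_inv_of_pos (by linarith),
        ENNReal.ofReal_add zero_le_one b.coe_nonneg]
      simp
    · intro x hx
      have hx' : (0 : ℝ) ≤ x := le_of_lt hx
      simp only
      rw [← ENNReal.ofReal_coe_nnreal, ← ENNReal.ofReal_mul hx',
        expNeg_ofReal (mul_nonneg hx' b.coe_nonneg), ← ENNReal.ofReal_mul (Real.exp_pos _).le,
        ← Real.exp_add]
      ring_nf

lemma expMeasure_ofReal_le (t : ℝ≥0∞) :
    expMeasure 1 {x | ENNReal.ofReal x ≤ t} = 1 - expNeg t := by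
  by_cases ht : t = ⊤
  · simp [ht]
  · lift t to ℝ≥0 using ht
    have : {x : ℝ | ENNReal.ofReal x ≤ t} = Set.Iic (t : ℝ) := by
      ext x
      change ENNReal.ofReal x ≤ t ↔ _
      rw [← ENNReal.ofReal_coe_nnreal, ENNReal.ofReal_le_ofReal_iff t.coe_nonneg,
        Set.mem_Iic]
    rw [this, ← ofReal_cdf, cdf_expMeasure_eq one_pos, if_pos t.coe_nonneg,
      ← ENNReal.ofReal_coe_nnreal, expNeg_ofReal t.coe_nonneg,
      ENNReal.ofReal_sub _ (Real.exp_pos _).le]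
    simp

end ExponentialLaw

/-! ### The planar path-loss integral. -/

section PathLossIntegral

lemma integral_plane_exp_neg_mul_rpow {p b : ℝ} (hp : 1 ≤ p) (hb : 0 < b) :
    ∫ x : Plane, Real.exp (-b * ‖x‖ ^ p) = Real.pi * b ^ (-2 / p) * Real.Gamma (2 / p + 1) := by
  rw [← Complex.integral_exp_neg_mul_rpow hp hb]
  have h := Complex.orthonormalBasisOneI.measurePreserving_repr
  rw [← h.integral_comp (Complex.orthonormalBasisOneI.repr.toHomeomorph.measurableEmbedding)]
  simp

lemma lintegral_plane_exp_neg_mul_rpow {p b : ℝ} (hp : 1 ≤ p) (hb : 0 < b) :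
    ∫⁻ x : Plane, ENNReal.ofReal (Real.exp (-b * ‖x‖ ^ p))
      = ENNReal.ofReal (Real.pi * b ^ (-2 / p) * Real.Gamma (2 / p + 1)) := by
  have hpos : 0 < Real.pi * b ^ (-2 / p) * Real.Gamma (2 / p + 1) := by
    have := Real.Gamma_pos_of_pos (s := 2 / p + 1) (by positivity)
    positivity
  have h := integral_plane_exp_neg_mul_rpow hp hb
  rw [← h, ofReal_integral_eq_lintegral_ofReal _ (ae_of_all _ fun x => (Real.exp_pos _).le)]
  exact Integrable.of_integral_ne_zero (by rw [h]; exact hpos.ne')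

lemma Gamma_mul_Gamma_eq {δ : ℝ} (h0 : 0 < δ) :
    Real.Gamma (δ + 1) * Real.Gamma (1 - δ) = Real.pi * δ / Real.sin (Real.pi * δ) := by
  rw [Real.Gamma_add_one h0.ne', mul_assoc, Real.Gamma_mul_Gamma_one_sub]
  ring

/-- The integral of `1 - 1 / (1 + s r ^ (-α))` over the plane. -/
lemma lintegral_pathLoss {α : ℝ} (hα : 2 < α) (x : Plane) {s : ℝ≥0∞} (hs : s ≠ ⊤) :
    ∫⁻ y : Plane, (1 - (1 + s * ENNReal.ofReal (dist y x) ^ (-α))⁻¹)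
      = ENNReal.ofReal (Real.pi / (Real.sin (Real.pi * (2 / α)) / (2 / α * Real.pi)))
        * s ^ (2 / α) := by
  have hδ0 : 0 < 2 / α := by positivity
  have hδ1 : 2 / α < 1 := by rw [div_lt_one (by linarith)]; exact hα
  have hα0 : 0 < α := by linarith
  rcases eq_or_ne s 0 with rfl | hs0
  · simp [hδ0]
  obtain ⟨σ, hσ, rfl⟩ : ∃ σ : ℝ, 0 < σ ∧ s = ENNReal.ofReal σ :=
    ⟨s.toReal, ENNReal.toReal_pos hs0 hs, (ENNReal.ofReal_toReal hs).symm⟩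
  -- With `r = ‖y - x‖`, the integrand equals `1 / (1 + r^α/σ)`, which is the mean of `exp(-V
  -- r^α/σ)` for an exponential `V`. Tonelli then allows integration over the plane before `V`.
  have h1 : ∀ᵐ y : Plane, 1 - (1 + ENNReal.ofReal σ * ENNReal.ofReal (dist y x) ^ (-α))⁻¹
      = ∫⁻ v, expNeg (ENNReal.ofReal v * ENNReal.ofReal (‖y - x‖ ^ α / σ)) ∂(expMeasure 1) := by
    have : ∀ᵐ y : Plane, y ≠ x := by
      rw [ae_iff]; simp
    filter_upwards [this] with y hy
    rw [lintegral_expMeasure_expNeg, dist_eq_norm]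
    set r := ‖y - x‖
    have hr : 0 < r := norm_pos_iff.2 (sub_ne_zero.2 hy)
    have hrα : 0 < r ^ α := Real.rpow_pos_of_pos hr _
    rw [ENNReal.ofReal_rpow_of_pos hr, ← ENNReal.ofReal_mul hσ.le, Real.rpow_neg hr.le,
      ← ENNReal.ofReal_one, ← ENNReal.ofReal_add zero_le_one (by positivity),
      ← ENNReal.ofReal_add zero_le_one (by positivity), ← ENNReal.ofReal_inv_of_pos (by positivity),
      ← ENNReal.ofReal_inv_of_pos (by positivity), ← ENNReal.ofReal_sub _ (by positivity)]
    congr 1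
    field_simp
    ring
  rw [lintegral_congr_ae h1,
    lintegral_sub_right_eq_self (fun z : Plane => ∫⁻ v, expNeg (ENNReal.ofReal v *
      ENNReal.ofReal (‖z‖ ^ α / σ)) ∂(expMeasure 1)) x, lintegral_lintegral_swap (by fun_prop),
    lintegral_expMeasure_one (by fun_prop)]
  -- The plane integral produces `Γ(1 + δ) (σ/v)^δ`; the remaining integral in `v` is `Γ(1 - δ)`,
  -- convergent as `δ < 1`, and the reflection formula finishes.
  have h2 : ∀ v ∈ Set.Ioi (0 : ℝ), ENNReal.ofReal (Real.exp (-v)) *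
      ∫⁻ y : Plane, expNeg (ENNReal.ofReal v * ENNReal.ofReal (‖y‖ ^ α / σ))
      = ENNReal.ofReal (Real.pi * σ ^ (2 / α) * Real.Gamma (2 / α + 1)) *
        ENNReal.ofReal (Real.exp (-v) * v ^ ((1 - 2 / α) - 1)) := by
    intro v hv
    have hv : 0 < v := hv
    have : ∀ y : Plane, expNeg (ENNReal.ofReal v * ENNReal.ofReal (‖y‖ ^ α / σ))
        = ENNReal.ofReal (Real.exp (-(v / σ) * ‖y‖ ^ α)) := by
      intro y
      rw [← ENNReal.ofReal_mul hv.le, expNeg_ofReal (by positivity)]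
      congr 2
      ring
    simp_rw [this]
    rw [lintegral_plane_exp_neg_mul_rpow (by linarith) (by positivity),
      ← ENNReal.ofReal_mul (by positivity), ← ENNReal.ofReal_mul
        (by have := Real.Gamma_pos_of_pos (s := 2 / α + 1) (by positivity); positivity)]
    congr 1
    rw [neg_div, Real.rpow_neg (by positivity), Real.div_rpow hv.le hσ.le,
      show 1 - 2 / α - 1 = -(2 / α) by ring, Real.rpow_neg hv.le]
    field_simp
  rw [setLIntegral_congr_fun measurableSet_Ioi h2, lintegral_const_mul _ (by fun_prop),
    ← ofReal_integral_eq_lintegral_ofReal (Real.GammaIntegral_convergent (by linarith))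
      ((ae_restrict_iff' measurableSet_Ioi).2 (ae_of_all _ fun v (hv : 0 < v) => by positivity)),
    ← Real.Gamma_eq_integral (by linarith), ENNReal.ofReal_rpow_of_pos hσ,
    ← ENNReal.ofReal_mul
        (by have := Real.Gamma_pos_of_pos (s := 2 / α + 1) (by positivity); positivity),
    ← ENNReal.ofReal_mul']
  · congr 1
    rw [mul_assoc, Gamma_mul_Gamma_eq hδ0]
    have : 0 < Real.sin (Real.pi * (2 / α)) :=
      Real.sin_pos_of_pos_of_lt_pi (by positivity) (by nlinarith [Real.pi_pos])
    field_simp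
  · positivity

end PathLossIntegral

/-! ### Laplace transform of Poisson interference. -/

section Laplace

variable {Ω : Type*} [MeasurableSpace Ω] {P : Measure Ω} [IsProbabilityMeasure P]

lemma lintegral_comp_indepFun {α β : Type*} [MeasurableSpace α] [MeasurableSpace β]
    {X : Ω → α} {Y : Ω → β} (hXY : IndepFun X Y P) (hX : Measurable X) (hY : Measurable Y)
    {F : α → β → ℝ≥0∞} (hF : Measurable (Function.uncurry F)) :
    ∫⁻ ω, F (X ω) (Y ω) ∂P = ∫⁻ ω, ∫⁻ ω', F (X ω) (Y ω') ∂P ∂P := by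
  have h := (indepFun_iff_map_prod_eq_prod_map_map hX.aemeasurable hY.aemeasurable).1 hXY
  have : IsProbabilityMeasure (P.map Y) := Measure.isProbabilityMeasure_map hY.aemeasurable
  calc ∫⁻ ω, F (X ω) (Y ω) ∂P
      = ∫⁻ q, Function.uncurry F q ∂(P.map fun ω => (X ω, Y ω)) :=
        (lintegral_map hF (hX.prodMk hY)).symm
    _ = ∫⁻ a, ∫⁻ b, F a b ∂(P.map Y) ∂(P.map X) := by
        rw [h, lintegral_prod _ hF.aemeasurable]; rfl
    _ = ∫⁻ ω, ∫⁻ b, F (X ω) b ∂(P.map Y) ∂P := lintegral_map hF.lintegral_prod_right' hX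
    _ = _ := lintegral_congr fun ω => lintegral_map (hF.comp measurable_prodMk_left) hY

/-- Finite products factorize by independence and pass to the limit by dominated convergence.
Writing the infinite product as `expNeg` of a sum of `negLog` values puts it in the form the Laplace
functional accepts. -/
lemma lintegral_expNeg_tsum_exponential {f : ℕ → Ω → ℝ} (hf : ∀ u, Measurable (f u))
    (hlaw : ∀ u, HasLaw (f u) (expMeasure 1) P) (hind : iIndepFun f P) (b : ℕ → ℝ≥0∞) :
    ∫⁻ ω, expNeg (∑' u, ENNReal.ofReal (f u ω) * b u) ∂P
      = expNeg (∑' u, negLog (1 + b u)⁻¹) := by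
  have hm : ∀ u, Measurable fun x : ℝ => expNeg (ENNReal.ofReal x * b u) := fun u => by fun_prop
  have h1 : Tendsto (fun m => ∫⁻ ω, ∏ u ∈ Finset.range m, expNeg (ENNReal.ofReal (f u ω) * b u) ∂P)
      atTop (𝓝 (∫⁻ ω, expNeg (∑' u, ENNReal.ofReal (f u ω) * b u) ∂P)) := by
    refine tendsto_lintegral_of_dominated_convergence (fun _ => 1) (fun m => by fun_prop)
      (fun m => ae_of_all _ fun ω => Finset.prod_le_one' fun u _ => expNeg_le_one _) (by simp)
      (ae_of_all _ fun ω => tendsto_prod_expNeg _)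
  refine tendsto_nhds_unique h1 ?_
  convert tendsto_prod_expNeg (fun u => negLog (1 + b u)⁻¹) using 2 with m
  rw [lintegral_prod_eq_prod_lintegral_of_indepFun _ (fun u ω => expNeg (ENNReal.ofReal (f u ω) * b u))
    (hind.comp _ hm) (fun u => (hm u).comp (hf u))]
  refine Finset.prod_congr rfl fun u _ => ?_
  rw [expNeg_negLog (by simp), ← lintegral_expMeasure_expNeg, ← (hlaw u).map_eq,
    lintegral_map (hm u) (hf u)]

/-- Moving the constraint on `u` into the summand makes the index set independent of the
configuration, as measurability and the averaging over a sequence of gains require. -/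
lemma received_eq (α : ℝ) (c : Config) (f : ℕ → ℝ) (x : Plane) :
    received α c f x = ∑' u : ℕ, ENNReal.ofReal (f u) *
      if (u : ℕ∞) < c.1 then ENNReal.ofReal (dist (c.2 u) x) ^ (-α) else 0 := by
  rw [received]
  refine (tsum_subtype {u : ℕ | (u : ℕ∞) < c.1} (fun u => ENNReal.ofReal (f u) *
    ENNReal.ofReal (dist (c.2 u) x) ^ (-α))).trans ?_
  exact tsum_congr fun u => by simp [Set.indicator_apply]

lemma measurable_received (α : ℝ) :
    Measurable fun q : Config × (ℕ → ℝ) × Plane => received α q.1 q.2.1 q.2.2 := by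
  simp_rw [received_eq]
  refine Measurable.tsum fun u => Measurable.mul (by fun_prop) ?_
  exact Measurable.ite (measurable_fst (measurableSet_lt_config u)) (by fun_prop) measurable_const

/-- Laplace transform of the interference from a Poisson field under Rayleigh fading. -/
theorem IsHPPP.lintegral_expNeg_received {Φ : Ω → Config} {l : ℝ≥0} (h : IsHPPP P Φ l)
    {f : ℕ → Ω → ℝ} (hf : ∀ u, Measurable (f u)) (hlaw : ∀ u, HasLaw (f u) (expMeasure 1) P)
    (hind : iIndepFun f P) (hΦf : IndepFun Φ (fun ω u => f u ω) P) {α : ℝ} (hα : 2 < α)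
    (x : Plane) {s : ℝ≥0∞} (hs : s ≠ ⊤) :
    ∫⁻ ω, expNeg (s * received α (Φ ω) (fun u => f u ω) x) ∂P
      = expNeg (l * (ENNReal.ofReal (Real.pi / (Real.sin (Real.pi * (2 / α)) / (2 / α * Real.pi)))
        * s ^ (2 / α))) := by
  have hF : Measurable (Function.uncurry fun (c : Config) (g : ℕ → ℝ) =>
      expNeg (s * received α c g x)) :=
    measurable_expNeg.comp (((measurable_received α).comp
      (measurable_fst.prodMk (measurable_snd.prodMk measurable_const))).const_mul s)
  rw [lintegral_comp_indepFun (F := fun c g => expNeg (s * received α c g x)) hΦf h.measurable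
    (measurable_pi_iff.2 hf) hF]
  have hg : Measurable fun y : Plane => negLog (1 + s * ENNReal.ofReal (dist y x) ^ (-α))⁻¹ := by
    fun_prop
  -- With the configuration frozen, averaging over the gains leaves the total of `g(y) = -log(1 / (1
  -- + s‖y - x‖^(-α)))`, so `1 - exp(-g)` is the path-loss integrand.
  have key : ∀ c : Config, ∫⁻ ω', expNeg (s * received α c (fun u => f u ω') x) ∂P
      = expNeg (c.total fun y => negLog (1 + s * ENNReal.ofReal (dist y x) ^ (-α))⁻¹) := by
    intro c
    simp_rw [received_eq, ← ENNReal.tsum_mul_left, mul_left_comm s]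
    rw [lintegral_expNeg_tsum_exponential hf hlaw hind, Config.total_eq]
    congr 2 with u
    split_ifs <;> simp
  simp_rw [key]
  rw [h.lintegral_expNeg_total hg, ← lintegral_pathLoss hα x hs]
  congr 2
  exact lintegral_congr fun y => by rw [expNeg_negLog (by simp)]

end Laplace

/-! ### Independence of functions of disjoint groups of sources. -/

section Grouping

variable {Ω ι κ : Type*} [mΩ : MeasurableSpace Ω] {P : Measure Ω} {m : ι → MeasurableSpace Ω}

lemma indepFun_of_disjoint {α β : Type*} [MeasurableSpace α] [MeasurableSpace β]
    (hle : ∀ i, m i ≤ mΩ) (hind : iIndep m P) {S T : Set ι} (hST : Disjoint S T)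
    {X : Ω → α} {Y : Ω → β} (hX : Measurable[⨆ i ∈ S, m i] X) (hY : Measurable[⨆ i ∈ T, m i] Y) :
    IndepFun X Y P :=
  indep_of_indep_of_le_left (indep_of_indep_of_le_right (indep_iSup_of_disjoint hle hind hST)
    hY.comap_le) hX.comap_le

/-- Induction on the finite set of events: each new group of sources is disjoint from the union of
the earlier ones. -/
lemma iIndepFun_of_disjoint [IsProbabilityMeasure P] {β : κ → Type*} [∀ k, MeasurableSpace (β k)]
    (hle : ∀ i, m i ≤ mΩ) (hind : iIndep m P) {S : κ → Set ι}
    (hS : Pairwise fun k l => Disjoint (S k) (S l)) {X : ∀ k, Ω → β k}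
    (hX : ∀ k, Measurable[⨆ i ∈ S k, m i] (X k)) : iIndepFun X P := by
  classical
  refine (iIndep_iff _ _).2 fun s f hf => ?_
  have hf' : ∀ k ∈ s, MeasurableSet[⨆ i ∈ S k, m i] (f k) := fun k hk => (hX k).comap_le _ (hf k hk)
  clear hf
  induction s using Finset.induction_on with
  | empty => simp
  | insert k s hk ih =>
    rw [Finset.prod_insert hk, Finset.set_biInter_insert,
      ← ih fun l hl => hf' l (Finset.mem_insert_of_mem hl)]
    have hd : Disjoint (S k) (⋃ l ∈ s, S l) := by
      rw [Set.disjoint_iUnion₂_right]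
      exact fun l hl => hS (fun h => hk (h ▸ hl))
    refine (Indep_iff _ _ _).1 (indep_iSup_of_disjoint hle hind hd) _ _
      (hf' k (Finset.mem_insert_self _ _)) ?_
    refine Finset.measurableSet_biInter s fun l hl => ?_
    have : (⨆ i ∈ S l, m i) ≤ ⨆ i ∈ ⋃ l ∈ s, S l, m i :=
      biSup_mono fun i hi => Set.mem_iUnion₂.2 ⟨l, hl, hi⟩
    exact this _ (hf' l (Finset.mem_insert_of_mem hl))

end Grouping

section SubAlgebra

variable {Ω ι : Type*} {m : MeasurableSpace Ω}

lemma measurable_of_mem {m : ι → MeasurableSpace Ω} {β : Type*} [MeasurableSpace β] {S : Set ι}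
    {i : ι} (hi : i ∈ S) {X : Ω → β} (hX : Measurable[m i] X) : Measurable[⨆ i ∈ S, m i] X :=
  hX.mono (le_iSup₂ (f := fun i (_ : i ∈ S) => m i) i hi) le_rfl

/-- The σ-algebra on `Ω` is a plain implicit argument here, so it can be a join of source σ-algebras
instead of the ambient one. -/
lemma measurable_pi_sub {β : ι → Type*} [∀ i, MeasurableSpace (β i)] {X : Ω → ∀ i, β i}
    (hX : ∀ i, Measurable[m] fun ω => X ω i) : Measurable[m] X := measurable_pi_lambda _ hX

lemma measurable_prodMk_sub {α β : Type*} [MeasurableSpace α] [MeasurableSpace β] {X : Ω → α}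
    {Y : Ω → β} (hX : Measurable[m] X) (hY : Measurable[m] Y) :
    Measurable[m] fun ω => (X ω, Y ω) := hX.prodMk hY

end SubAlgebra

/-! ### Marks of the stations and their independence. -/

/-- A configuration of transmitters with its channel gains. -/
abbrev Field : Type := Config × (ℕ → ℝ)

/-- All random inputs attached to one base station. -/
abbrev Mark (N : ℕ) : Type := (Fin N → ℝ) × (Fin N → Field) × (Fin N → Field)

/-- The base station to which a random input is attached. -/
def Source.station {N : ℕ} : Source N → Option ℕ
  | .bs => none
  | .signal _ j => some j
  | .iot _ j => some j
  | .iotFading _ j _ => some j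
  | .inc _ j => some j
  | .incFading _ j _ => some j

/-- The message to which a random input is attached. -/
def Source.message {N : ℕ} : Source N → Option (Fin N)
  | .bs => none
  | .signal i _ => some i
  | .iot i _ => some i
  | .iotFading i _ _ => some i
  | .inc i _ => some i
  | .incFading i _ _ => some i

/-- The kind of a random input: signal gains, interfering devices, or incumbents. -/
def Source.kind {N : ℕ} : Source N → ℕ
  | .bs => 0
  | .signal _ _ => 1
  | .iot _ _ => 2
  | .iotFading _ _ _ => 2
  | .inc _ _ => 3
  | .incFading _ _ _ => 3

/-- The interference-plus-noise power at `x`, from noise `n` and the fields `a` and `b`. -/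
def disturbance (p : Params) (n : ℝ) (x : Plane) (a b : Field) : ℝ≥0∞ :=
  ENNReal.ofReal n + received p.α a.1 a.2 x + ENNReal.ofReal p.PIhat * received p.α b.1 b.2 x

lemma measurable_disturbance (p : Params) (n : ℝ) :
    Measurable fun q : Plane × Field × Field => disturbance p n q.1 q.2.1 q.2.2 := by
  have h1 : Measurable fun q : Plane × Field × Field => received p.α q.2.1.1 q.2.1.2 q.1 :=
    (measurable_received p.α).comp (f := fun q : Plane × Field × Field => (q.2.1.1, q.2.1.2, q.1))
      (by fun_prop)
  have h2 : Measurable fun q : Plane × Field × Field => received p.α q.2.2.1 q.2.2.2 q.1 :=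
    (measurable_received p.α).comp (f := fun q : Plane × Field × Field => (q.2.2.1, q.2.2.2, q.1))
      (by fun_prop)
  exact (h1.const_add _).add (h2.const_mul _)

/-- The set of locations and marks for which no message is decoded. -/
def failSet (p : Params) (s : Repetition) (n : ℝ) : Set (Plane × Mark p.N) :=
  {q | (⨆ i : Fin p.N, ENNReal.ofReal (q.2.1 i) * ENNReal.ofReal ‖q.1‖ ^ (-p.α) /
    disturbance p n q.1 (q.2.2.1 (s.pick i)) (q.2.2.2 i)) ≤ ENNReal.ofReal p.τ}

lemma measurableSet_failSet (p : Params) (s : Repetition) (n : ℝ) :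
    MeasurableSet (failSet p s n) := by
  refine measurableSet_le (Measurable.iSup fun i => Measurable.div (by fun_prop) ?_)
    measurable_const
  exact (measurable_disturbance p n).comp (f := fun q : Plane × Mark p.N =>
    (q.1, q.2.2.1 (s.pick i), q.2.2.2 i)) (by fun_prop)

namespace Network

variable {p : Params} {Ω : Type*} [mΩ : MeasurableSpace Ω] {P : Measure Ω} (W : Network p P)

/-- The σ-algebra generated by a random input. -/
@[reducible]
def sourceAlgebra : Source p.N → MeasurableSpace Ω
  | .bs => MeasurableSpace.comap W.bs inferInstance
  | .signal i j => MeasurableSpace.comap (W.h i j) inferInstance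
  | .iot i j => MeasurableSpace.comap (W.iot i j) inferInstance
  | .iotFading i j u => MeasurableSpace.comap (W.fIoT i j u) inferInstance
  | .inc i j => MeasurableSpace.comap (W.inc i j) inferInstance
  | .incFading i j u => MeasurableSpace.comap (W.fInc i j u) inferInstance

lemma iIndep_sourceAlgebra : iIndep W.sourceAlgebra P := W.indep

lemma sourceAlgebra_le (s : Source p.N) : W.sourceAlgebra s ≤ mΩ := by
  cases s with
  | bs => exact W.bs_hppp.measurable.comap_le
  | signal i j => exact (W.h_measurable i j).comap_le
  | iot i j => exact (W.iot_hppp i j).measurable.comap_le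
  | iotFading i j u => exact (W.fIoT_measurable i j u).comap_le
  | inc i j => exact (W.inc_hppp i j).measurable.comap_le
  | incFading i j u => exact (W.fInc_measurable i j u).comap_le

/-- Interfering devices with their gains. -/
def iotField (i : Fin p.N) (j : ℕ) (ω : Ω) : Field := (W.iot i j ω, fun u => W.fIoT i j u ω)

/-- Interfering incumbents with their gains. -/
def incField (i : Fin p.N) (j : ℕ) (ω : Ω) : Field := (W.inc i j ω, fun u => W.fInc i j u ω)

/-- All random inputs attached to base station `j`. -/
def mark (j : ℕ) (ω : Ω) : Mark p.N :=
  (fun i => W.h i j ω, fun i => W.iotField i j ω, fun i => W.incField i j ω)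

section Measurability

variable {W} {S : Set (Source p.N)} {i : Fin p.N} {j : ℕ}

lemma measurable_bs_of_mem (h : .bs ∈ S) : Measurable[⨆ s ∈ S, W.sourceAlgebra s] W.bs :=
  measurable_of_mem (m := W.sourceAlgebra) h (comap_measurable _)

lemma measurable_h_of_mem (h : .signal i j ∈ S) : Measurable[⨆ s ∈ S, W.sourceAlgebra s] (W.h i j) :=
  measurable_of_mem (m := W.sourceAlgebra) h (comap_measurable _)

lemma measurable_iot_of_mem (h : .iot i j ∈ S) :
    Measurable[⨆ s ∈ S, W.sourceAlgebra s] (W.iot i j) :=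
  measurable_of_mem (m := W.sourceAlgebra) h (comap_measurable _)

lemma measurable_inc_of_mem (h : .inc i j ∈ S) :
    Measurable[⨆ s ∈ S, W.sourceAlgebra s] (W.inc i j) :=
  measurable_of_mem (m := W.sourceAlgebra) h (comap_measurable _)

lemma measurable_fIoT_of_mem {u : ℕ} (h : .iotFading i j u ∈ S) :
    Measurable[⨆ s ∈ S, W.sourceAlgebra s] (W.fIoT i j u) :=
  measurable_of_mem (m := W.sourceAlgebra) h (comap_measurable _)

lemma measurable_fInc_of_mem {u : ℕ} (h : .incFading i j u ∈ S) :
    Measurable[⨆ s ∈ S, W.sourceAlgebra s] (W.fInc i j u) :=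
  measurable_of_mem (m := W.sourceAlgebra) h (comap_measurable _)

lemma measurable_iotField_of_mem (h : .iot i j ∈ S) (h' : ∀ u, .iotFading i j u ∈ S) :
    Measurable[⨆ s ∈ S, W.sourceAlgebra s] (W.iotField i j) :=
  measurable_prodMk_sub (measurable_iot_of_mem h)
    (measurable_pi_sub fun u => measurable_fIoT_of_mem (h' u))

lemma measurable_incField_of_mem (h : .inc i j ∈ S) (h' : ∀ u, .incFading i j u ∈ S) :
    Measurable[⨆ s ∈ S, W.sourceAlgebra s] (W.incField i j) :=
  measurable_prodMk_sub (measurable_inc_of_mem h)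
    (measurable_pi_sub fun u => measurable_fInc_of_mem (h' u))

lemma measurable_mark_of_subset (h : {s | s.station = some j} ⊆ S) :
    Measurable[⨆ s ∈ S, W.sourceAlgebra s] (W.mark j) := by
  refine measurable_prodMk_sub ?_ (measurable_prodMk_sub ?_ ?_)
  · exact measurable_pi_sub fun i => measurable_h_of_mem (h rfl)
  · exact measurable_pi_sub fun i => measurable_iotField_of_mem (h rfl) fun u => h rfl
  · exact measurable_pi_sub fun i => measurable_incField_of_mem (h rfl) fun u => h rfl

lemma iSup_sourceAlgebra_le : ⨆ s ∈ S, W.sourceAlgebra s ≤ mΩ :=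
  iSup₂_le fun s _ => W.sourceAlgebra_le s

variable (W)

@[fun_prop]
lemma measurable_mark (j : ℕ) : Measurable (W.mark j) :=
  (measurable_mark_of_subset (Set.subset_univ _)).mono iSup_sourceAlgebra_le le_rfl

@[fun_prop]
lemma measurable_iotField (i : Fin p.N) (j : ℕ) : Measurable (W.iotField i j) :=
  (measurable_iotField_of_mem (Set.mem_univ _) fun _ => Set.mem_univ _).mono
    iSup_sourceAlgebra_le le_rfl

@[fun_prop]
lemma measurable_incField (i : Fin p.N) (j : ℕ) : Measurable (W.incField i j) :=
  (measurable_incField_of_mem (Set.mem_univ _) fun _ => Set.mem_univ _).mono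
    iSup_sourceAlgebra_le le_rfl

end Measurability

section Independence

/-- Fibres of `Source.station` are the disjoint groups here; `Source.message` and `Source.kind` play
the same role for several of the independence statements that follow. -/
lemma indepFun_bs_mark : IndepFun W.bs (fun ω j => W.mark j ω) P := by
  refine indepFun_of_disjoint W.sourceAlgebra_le W.iIndep_sourceAlgebra
    (S := {s | s.station = none}) (T := {s | s.station ≠ none}) ?_
    (measurable_bs_of_mem rfl) ?_
  · exact Set.disjoint_left.2 fun s h h' => h' h
  · exact measurable_pi_sub fun j => measurable_mark_of_subset fun s (hs : _ = _) => by
      simp [hs]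

lemma iIndepFun_fIoT (i : Fin p.N) (j : ℕ) : iIndepFun (fun u => W.fIoT i j u) P :=
  W.iIndep_sourceAlgebra.precomp (g := fun u => Source.iotFading i j u) fun u v h => by
    simpa using h

lemma iIndepFun_fInc (i : Fin p.N) (j : ℕ) : iIndepFun (fun u => W.fInc i j u) P :=
  W.iIndep_sourceAlgebra.precomp (g := fun u => Source.incFading i j u) fun u v h => by
    simpa using h

lemma iIndepFun_mark [IsProbabilityMeasure P] : iIndepFun W.mark P :=
  iIndepFun_of_disjoint W.sourceAlgebra_le W.iIndep_sourceAlgebra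
    (S := fun j => {s | s.station = some j})
    (fun k l hkl => Set.disjoint_left.2 fun s (h : _ = _) (h' : _ = _) => hkl (by simpa [h] using h'))
    fun j => measurable_mark_of_subset subset_rfl

lemma indepFun_fields_h (j : ℕ) :
    IndepFun (fun ω (i : Fin p.N) => (W.iotField i j ω, W.incField i j ω))
      (fun ω i => W.h i j ω) P := by
  refine indepFun_of_disjoint W.sourceAlgebra_le W.iIndep_sourceAlgebra
    (S := {s | s.kind ≠ 1}) (T := {s | s.kind = 1}) (Set.disjoint_left.2 fun s h h' => h h') ?_ ?_
  · refine measurable_pi_sub fun i => measurable_prodMk_sub ?_ ?_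
    · exact measurable_iotField_of_mem (by simp [Source.kind]) (by simp [Source.kind])
    · exact measurable_incField_of_mem (by simp [Source.kind]) (by simp [Source.kind])
  · exact measurable_pi_sub fun i => measurable_h_of_mem rfl

lemma iIndepFun_h [IsProbabilityMeasure P] (j : ℕ) : iIndepFun (fun i => W.h i j) P :=
  iIndepFun_of_disjoint W.sourceAlgebra_le W.iIndep_sourceAlgebra
    (S := fun i => {s | s.message = some i})
    (fun k l hkl => Set.disjoint_left.2 fun s (h : _ = _) (h' : _ = _) => hkl (by simpa [h] using h'))
    fun i => measurable_h_of_mem rfl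

lemma iIndepFun_fields [IsProbabilityMeasure P] (j : ℕ) :
    iIndepFun (fun i ω => (W.iotField i j ω, W.incField i j ω)) P :=
  iIndepFun_of_disjoint W.sourceAlgebra_le W.iIndep_sourceAlgebra
    (S := fun i => {s | s.message = some i})
    (fun k l hkl => Set.disjoint_left.2 fun s (h : _ = _) (h' : _ = _) => hkl (by simpa [h] using h'))
    fun i => measurable_prodMk_sub (measurable_iotField_of_mem rfl fun _ => rfl)
      (measurable_incField_of_mem rfl fun _ => rfl)

lemma iIndepFun_incField [IsProbabilityMeasure P] (j : ℕ) : iIndepFun (fun i => W.incField i j) P :=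
  (W.iIndepFun_fields j).comp (fun _ => Prod.snd) fun _ => measurable_snd

lemma indepFun_iotField_incFields (i : Fin p.N) (j : ℕ) :
    IndepFun (W.iotField i j) (fun ω i' => W.incField i' j ω) P := by
  refine indepFun_of_disjoint W.sourceAlgebra_le W.iIndep_sourceAlgebra
    (S := {s | s.kind = 2}) (T := {s | s.kind = 3}) ?_ ?_ ?_
  · exact Set.disjoint_left.2 fun s (h : _ = _) (h' : _ = _) => by simp [h] at h'
  · exact measurable_iotField_of_mem rfl fun _ => rfl
  · exact measurable_pi_sub fun i => measurable_incField_of_mem rfl fun _ => rfl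

lemma indepFun_iotField_incField (i i' : Fin p.N) (j : ℕ) :
    IndepFun (W.iotField i j) (W.incField i' j) P :=
  (W.indepFun_iotField_incFields i j).comp measurable_id (measurable_pi_apply i')

lemma indepFun_iot_fIoT (i : Fin p.N) (j : ℕ) :
    IndepFun (W.iot i j) (fun ω u => W.fIoT i j u ω) P := by
  refine indepFun_of_disjoint W.sourceAlgebra_le W.iIndep_sourceAlgebra
    (S := {.iot i j}) (T := {.iot i j}ᶜ) disjoint_compl_right
    (measurable_iot_of_mem rfl) ?_
  exact measurable_pi_sub fun u => measurable_fIoT_of_mem (by simp)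

lemma indepFun_inc_fInc (i : Fin p.N) (j : ℕ) :
    IndepFun (W.inc i j) (fun ω u => W.fInc i j u ω) P := by
  refine indepFun_of_disjoint W.sourceAlgebra_le W.iIndep_sourceAlgebra
    (S := {.inc i j}) (T := {.inc i j}ᶜ) disjoint_compl_right
    (measurable_inc_of_mem rfl) ?_
  exact measurable_pi_sub fun u => measurable_fInc_of_mem (by simp)

end Independence

end Network

/-! ### Failure probability of one station. -/

section

namespace Params

variable (p : Params)

lemma N_pos : 0 < p.N := p.one_le_N

lemma α_pos : 0 < p.α := two_pos.trans p.two_lt_α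

lemma δ_pos : 0 < p.δ := div_pos two_pos p.α_pos

lemma δ_lt_one : p.δ < 1 := (div_lt_one p.α_pos).2 p.two_lt_α

lemma ξ_pos : 0 < p.ξ := by
  have h0 := p.δ_pos
  have h1 := p.δ_lt_one
  exact div_pos (Real.sin_pos_of_pos_of_lt_pi (by positivity) (by nlinarith [Real.pi_pos]))
    (by positivity)

lemma PIhat_pos : 0 < p.PIhat :=
  div_pos (div_pos (mul_pos p.PI_pos p.b_pos) p.BI_pos) p.PIoT_pos

lemma iot_factor_pos : 0 < p.N * p.βT * p.lamT * (p.βF * p.b / (p.M * p.B)) := by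
  have h1 : 0 < p.βT := one_pos.trans_le p.one_le_βT
  have h2 : 0 < p.βF := one_pos.trans_le p.one_le_βF
  have h3 : (0 : ℝ) < p.N := by exact_mod_cast p.N_pos
  have h4 : (0 : ℝ) < p.M := by exact_mod_cast p.one_le_M
  have h5 : 0 < p.lamT := div_pos p.t_pos p.T_pos
  have := p.b_pos
  have := p.B_pos
  positivity

lemma inc_factor_pos : 0 < min 1 (p.BI / (p.M * p.B)) := by
  have h4 : (0 : ℝ) < p.M := by exact_mod_cast p.one_le_M
  exact lt_min one_pos (div_pos p.BI_pos (mul_pos h4 p.B_pos))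

lemma lamIoTtilde_nonneg : 0 ≤ p.lamIoTtilde := mul_nonneg p.iot_factor_pos.le p.lamIoT_nonneg

lemma lamItilde_nonneg : 0 ≤ p.lamItilde := mul_nonneg p.inc_factor_pos.le p.lamI_nonneg

lemma lamTilde_pos : 0 < p.lamIoTtilde ∨ 0 < p.lamItilde := by
  rcases p.lamIoT_nonneg.eq_or_lt with h | h
  · exact Or.inr (mul_pos p.inc_factor_pos (by have := p.lam_pos; linarith))
  · exact Or.inl (mul_pos p.iot_factor_pos h)

/-- Interference rate seen by `k` simultaneous decoding attempts. -/
def rate (s : Repetition) (k : ℕ) : ℝ := match s with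
  | .pn => (k : ℝ) ^ p.δ * p.lamIoTtilde + k * p.PIhat ^ p.δ * p.lamItilde
  | .random => k * (p.lamIoTtilde + p.PIhat ^ p.δ * p.lamItilde)

lemma rate_pos (s : Repetition) {k : ℕ} (hk : 0 < k) : 0 < p.rate s k := by
  have hk' : (0 : ℝ) < k := by exact_mod_cast hk
  have h1 : 0 < (k : ℝ) ^ p.δ := by positivity
  have h2 : 0 < p.PIhat ^ p.δ := Real.rpow_pos_of_pos p.PIhat_pos _
  have h3 := p.lamIoTtilde_nonneg
  have h4 := p.lamItilde_nonneg
  rcases p.lamTilde_pos with h | h <;> cases s <;> simp only [rate] <;> positivity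

lemma rate_zero (s : Repetition) : p.rate s 0 = 0 := by
  cases s <;> simp [rate, Real.zero_rpow p.δ_pos.ne']

/-- Exponent governing the probability that `k` given messages are all decoded at distance `r`. -/
def exponent (s : Repetition) (n : ℝ) (k : ℕ) (r : ℝ) : ℝ :=
  Real.pi / p.ξ * p.τ ^ p.δ * p.rate s k * r ^ 2 + k * n * p.τ * r ^ p.α

end Params

section Algebra

variable {Ω : Type*} [MeasurableSpace Ω] {P : Measure Ω} [IsProbabilityMeasure P]

/-- Binomial expansion under the integral. It serves both schemes: `X` is the random device factor
for PN repetition and a constant, its mean, for random repetition. -/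
lemma toReal_lintegral_one_sub_mul_pow {X : Ω → ℝ≥0∞} (hX : Measurable X) (hX1 : ∀ ω, X ω ≤ 1)
    {c : ℝ≥0∞} (hc : c ≤ 1) (N : ℕ) :
    (∫⁻ ω, (1 - c * X ω) ^ N ∂P).toReal = ∑ k ∈ Finset.range (N + 1),
      (N.choose k : ℝ) * (-1) ^ k * (c.toReal ^ k * (∫⁻ ω, X ω ^ k ∂P).toReal) := by
  have hX' : ∀ ω, X ω ≠ ⊤ := fun ω => ne_top_of_le_ne_top ENNReal.one_ne_top (hX1 ω)
  have hr : ∀ ω, ‖(X ω).toReal‖ ≤ 1 := fun ω => by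
    rw [Real.norm_of_nonneg ENNReal.toReal_nonneg]
    exact ENNReal.toReal_le_of_le_ofReal zero_le_one (by simpa using hX1 ω)
  have hint : ∀ k : ℕ, Integrable (fun ω => (X ω).toReal ^ k) P := fun k =>
    Integrable.of_bound (hX.ennreal_toReal.pow_const k).aestronglyMeasurable 1
      (ae_of_all _ fun ω => by rw [norm_pow]; exact pow_le_one₀ (norm_nonneg _) (hr ω))
  have hk : ∀ k : ℕ, (∫⁻ ω, X ω ^ k ∂P).toReal = ∫ ω, (X ω).toReal ^ k ∂P := fun k => by
    rw [← integral_toReal (hX.pow_const k).aemeasurable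
      (ae_of_all _ fun ω => ENNReal.pow_lt_top (hX' ω).lt_top)]
    simp_rw [ENNReal.toReal_pow]
  rw [← integral_toReal (by fun_prop) (ae_of_all _ fun ω => ENNReal.pow_lt_top
    (tsub_le_self.trans_lt ENNReal.one_lt_top))]
  have : ∀ ω, ((1 - c * X ω) ^ N).toReal = ∑ k ∈ Finset.range (N + 1),
      (N.choose k : ℝ) * (-1) ^ k * (c.toReal ^ k * (X ω).toReal ^ k) := fun ω => by
    rw [ENNReal.toReal_pow, ENNReal.toReal_sub_of_le (mul_le_one' hc (hX1 ω)) ENNReal.one_ne_top,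
      ENNReal.toReal_mul, ENNReal.toReal_one, sub_eq_neg_add, add_pow]
    refine Finset.sum_congr rfl fun k _ => ?_
    rw [neg_pow, mul_pow, one_pow]
    ring
  simp_rw [this, hk]
  rw [integral_finsetSum _ fun k _ => ((hint k).const_mul _).const_mul _]
  simp_rw [integral_const_mul]

/-- Jensen's inequality for `y ↦ y^N`, obtained from the monotonicity of `L^q` norms on a
probability space between exponents `1` and `N`. This is the source of the comparison of the two
schemes. -/
lemma one_sub_mul_lintegral_pow_le {X : Ω → ℝ≥0∞} (hX : Measurable X) (hX1 : ∀ ω, X ω ≤ 1)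
    {c : ℝ≥0∞} (hc : c ≤ 1) {N : ℕ} (hN : 0 < N) :
    (1 - c * ∫⁻ ω, X ω ∂P) ^ N ≤ ∫⁻ ω, (1 - c * X ω) ^ N ∂P := by
  have h1 : 1 - c * ∫⁻ ω, X ω ∂P = ∫⁻ ω, (1 - c * X ω) ∂P := by
    have hle : ∫⁻ ω, c * X ω ∂P ≤ 1 := by
      simpa using lintegral_mono (μ := P) fun ω => mul_le_one' hc (hX1 ω)
    rw [lintegral_sub (hX.const_mul _) (ne_top_of_le_ne_top ENNReal.one_ne_top hle)
      (ae_of_all _ fun ω => mul_le_one' hc (hX1 ω)), lintegral_const_mul _ hX]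
    simp
  rw [h1]
  have hY : Measurable fun ω => 1 - c * X ω := by fun_prop
  have h := eLpNorm'_le_eLpNorm'_of_exponent_le one_pos
    (show (1 : ℝ) ≤ N by exact_mod_cast hN) P hY.aestronglyMeasurable
  have hN' : (N : ℝ) ≠ 0 := by exact_mod_cast hN.ne'
  simp only [eLpNorm', enorm_eq_self, ENNReal.rpow_one, ENNReal.rpow_natCast, div_one] at h
  calc (∫⁻ ω, (1 - c * X ω) ∂P) ^ N
      ≤ ((∫⁻ ω, (1 - c * X ω) ^ N ∂P) ^ (1 / (N : ℝ))) ^ N := pow_le_pow_left' h N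
    _ = _ := by rw [← ENNReal.rpow_natCast, ← ENNReal.rpow_mul, one_div_mul_cancel hN',
      ENNReal.rpow_one]

end Algebra

/-- Valid also for `d = 0` and `d = ∞`, so absent noise and interference, or infinite interference,
need no separate treatment. -/
lemma decode_iff {a d τ t : ℝ≥0∞} (ha0 : a ≠ 0) (ha : a ≠ ⊤) (hτ0 : τ ≠ 0) (hτ : τ ≠ ⊤) :
    t * a / d ≤ τ ↔ t ≤ τ / a * d := by
  rw [ENNReal.div_le_iff_le_mul (Or.inr hτ) (Or.inr hτ0),
    ← ENNReal.le_div_iff_mul_le (Or.inl ha0) (Or.inl ha), ENNReal.mul_div_right_comm]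

namespace Network

variable {p : Params} {Ω : Type*} [mΩ : MeasurableSpace Ω] {P : Measure Ω}
  (W : Network p P)

lemma failProb_eq (s : Repetition) (n : ℝ) (j : ℕ) (x : Plane) :
    W.failProb s n j x = (P {ω | (x, W.mark j ω) ∈ failSet p s n}).toReal := rfl

/-- Received powers at `x`, from the interfering devices. -/
def iotPower (i : Fin p.N) (j : ℕ) (x : Plane) (ω : Ω) : ℝ≥0∞ :=
  received p.α (W.iotField i j ω).1 (W.iotField i j ω).2 x

/-- Received powers at `x`, from the incumbents. -/
def incPower (i : Fin p.N) (j : ℕ) (x : Plane) (ω : Ω) : ℝ≥0∞ :=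
  received p.α (W.incField i j ω).1 (W.incField i j ω).2 x

lemma measurable_fieldPower (α : ℝ) (x : Plane) :
    Measurable fun a : Field => received α a.1 a.2 x :=
  (measurable_received α).comp (f := fun a : Field => (a.1, a.2, x)) (by fun_prop)

lemma measurable_iotPower (i : Fin p.N) (j : ℕ) (x : Plane) : Measurable (W.iotPower i j x) :=
  (measurable_fieldPower p.α x).comp (W.measurable_iotField i j)

lemma measurable_incPower (i : Fin p.N) (j : ℕ) (x : Plane) : Measurable (W.incPower i j x) :=
  (measurable_fieldPower p.α x).comp (W.measurable_incField i j)

lemma lintegral_expNeg_iotPower [IsProbabilityMeasure P] (i : Fin p.N) (j : ℕ) (x : Plane) {σ : ℝ≥0∞} (hσ : σ ≠ ⊤) :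
    ∫⁻ ω, expNeg (σ * W.iotPower i j x ω) ∂P
      = expNeg (p.lamIoTtilde.toNNReal * (ENNReal.ofReal (Real.pi / p.ξ) * σ ^ p.δ)) :=
  (W.iot_hppp i j).lintegral_expNeg_received (W.fIoT_measurable i j) (W.fIoT_law i j)
    (W.iIndepFun_fIoT i j) (W.indepFun_iot_fIoT i j) p.two_lt_α x hσ

lemma lintegral_expNeg_incPower [IsProbabilityMeasure P] (i : Fin p.N) (j : ℕ) (x : Plane) {σ : ℝ≥0∞} (hσ : σ ≠ ⊤) :
    ∫⁻ ω, expNeg (σ * W.incPower i j x ω) ∂P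
      = expNeg (p.lamItilde.toNNReal * (ENNReal.ofReal (Real.pi / p.ξ) * σ ^ p.δ)) :=
  (W.inc_hppp i j).lintegral_expNeg_received (W.fInc_measurable i j) (W.fInc_law i j)
    (W.iIndepFun_fInc i j) (W.indepFun_inc_fInc i j) p.two_lt_α x hσ

/-- Failure probability at `x`, after averaging over the signal gains. -/
lemma measure_fail_eq_lintegral [IsProbabilityMeasure P] (s : Repetition) (n : ℝ) (j : ℕ) {x : Plane} (hx : x ≠ 0) :
    P {ω | (x, W.mark j ω) ∈ failSet p s n} = ∫⁻ ω, ∏ i : Fin p.N,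
      (1 - expNeg (ENNReal.ofReal p.τ / ENNReal.ofReal ‖x‖ ^ (-p.α) *
        (ENNReal.ofReal n + W.iotPower (s.pick i) j x ω
          + ENNReal.ofReal p.PIhat * W.incPower i j x ω))) ∂P := by
  classical
  set σ := ENNReal.ofReal p.τ / ENNReal.ofReal ‖x‖ ^ (-p.α) with hσ
  have ha0 : ENNReal.ofReal ‖x‖ ^ (-p.α) ≠ 0 := by simp [ENNReal.rpow_eq_zero_iff, hx]
  have ha : ENNReal.ofReal ‖x‖ ^ (-p.α) ≠ ⊤ := by simp [ENNReal.rpow_eq_top_iff, hx]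
  have hτ0 : ENNReal.ofReal p.τ ≠ 0 := by simpa using p.τ_pos
  -- The indicator of total failure is a product over messages, so once the fields are frozen it
  -- factorizes over the independent signal gains.
  let F : (Fin p.N → Field × Field) → (Fin p.N → ℝ) → ℝ≥0∞ := fun a t => ∏ i,
    if ENNReal.ofReal (t i) ≤ σ * disturbance p n x (a (s.pick i)).1 (a i).2 then 1 else 0
  have hD : ∀ i, Measurable fun a : Fin p.N → Field × Field =>
      disturbance p n x (a (s.pick i)).1 (a i).2 := fun i =>
    (measurable_disturbance p n).comp (f := fun a : Fin p.N → Field × Field =>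
      (x, (a (s.pick i)).1, (a i).2)) (by fun_prop)
  have hF : Measurable (Function.uncurry F) := by
    refine Finset.measurable_prod _ fun i _ => Measurable.ite ?_ measurable_const measurable_const
    exact measurableSet_le (by fun_prop) (((hD i).comp measurable_fst).const_mul _)
  have hmem : ∀ ω, ({ω | (x, W.mark j ω) ∈ failSet p s n} : Set Ω).indicator 1 ω
      = F (fun i => (W.iotField i j ω, W.incField i j ω)) (fun i => W.h i j ω) := by
    intro ω
    have : (x, W.mark j ω) ∈ failSet p s n ↔ ∀ i : Fin p.N, ENNReal.ofReal (W.h i j ω) ≤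
        σ * disturbance p n x (W.iotField (s.pick i) j ω) (W.incField i j ω) := by
      refine iSup_le_iff.trans (forall_congr' fun i => decode_iff ha0 ha hτ0 ENNReal.ofReal_ne_top)
    simp only [F]
    rw [Finset.prod_ite_zero, Set.indicator_apply]
    simp [this]
  refine (lintegral_indicator_one ((measurableSet_failSet p s n).preimage
      (measurable_const.prodMk (W.measurable_mark j)))).symm.trans ((lintegral_congr hmem).trans ?_)
  have hXm : Measurable fun ω (i : Fin p.N) => (W.iotField i j ω, W.incField i j ω) :=
    measurable_pi_lambda _ fun i => (W.measurable_iotField i j).prodMk (W.measurable_incField i j)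
  rw [lintegral_comp_indepFun (W.indepFun_fields_h j) hXm
    (measurable_pi_lambda _ fun i => W.h_measurable i j) hF]
  refine lintegral_congr fun ω => ?_
  have hset : ∀ d : ℝ≥0∞, Measurable fun t : ℝ => if ENNReal.ofReal t ≤ d then (1 : ℝ≥0∞) else 0 :=
    fun d => Measurable.ite (measurableSet_le (by fun_prop) measurable_const) measurable_const
      measurable_const
  simp only [F]
  rw [lintegral_prod_eq_prod_lintegral_of_indepFun _ (fun i ω' => if ENNReal.ofReal (W.h i j ω') ≤
      σ * disturbance p n x (W.iotField (s.pick i) j ω) (W.incField i j ω) then (1 : ℝ≥0∞) else 0)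
    ((W.iIndepFun_h j).comp (fun i t => if ENNReal.ofReal t ≤
      σ * disturbance p n x (W.iotField (s.pick i) j ω) (W.incField i j ω) then (1 : ℝ≥0∞) else 0)
      fun i => hset _) (fun i => (hset _).comp (W.h_measurable i j))]
  refine Finset.prod_congr rfl fun i _ => ?_
  set d := disturbance p n x (W.iotField (s.pick i) j ω) (W.incField i j ω) with hd
  rw [← lintegral_map (hset _) (W.h_measurable i j), (W.h_law i j).map_eq]
  calc _ = ∫⁻ t, {t : ℝ | ENNReal.ofReal t ≤ σ * d}.indicator 1 t ∂(expMeasure 1) :=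
        lintegral_congr fun t => by simp [Set.indicator_apply]
    _ = _ := by
      rw [lintegral_indicator_one (measurableSet_le (by fun_prop) measurable_const),
        expMeasure_ofReal_le]
      rfl

/-- The attenuated noise and incumbent terms of the success probability of one message. -/
def attenuation (p : Params) (n : ℝ) (σ : ℝ≥0∞) : ℝ≥0∞ :=
  expNeg (σ * ENNReal.ofReal n) * expNeg (p.lamItilde.toNNReal *
    (ENNReal.ofReal (Real.pi / p.ξ) * (σ * ENNReal.ofReal p.PIhat) ^ p.δ))

lemma attenuation_le_one (p : Params) (n : ℝ) (σ : ℝ≥0∞) : attenuation p n σ ≤ 1 :=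
  mul_le_one' (expNeg_le_one _) (expNeg_le_one _)

variable [IsProbabilityMeasure P]

lemma decodeScale_eq (p : Params) {x : Plane} (hx : x ≠ 0) :
    ENNReal.ofReal p.τ / ENNReal.ofReal ‖x‖ ^ (-p.α) = ENNReal.ofReal (p.τ * ‖x‖ ^ p.α) := by
  have hx' : 0 < ‖x‖ := norm_pos_iff.2 hx
  rw [ENNReal.ofReal_rpow_of_pos hx', ← ENNReal.ofReal_div_of_pos (Real.rpow_pos_of_pos hx' _),
    Real.rpow_neg hx'.le, div_inv_eq_mul]

/-- Conditionally on the shared devices, the messages meet independent incumbents, so the `N`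
factors are independent with equal means; the power stays inside the average over the devices. -/
lemma measure_fail_pn (n : ℝ) (j : ℕ) {x : Plane} (hx : x ≠ 0) :
    P {ω | (x, W.mark j ω) ∈ failSet p .pn n} = ∫⁻ ω,
      (1 - attenuation p n (ENNReal.ofReal (p.τ * ‖x‖ ^ p.α)) *
        expNeg (ENNReal.ofReal (p.τ * ‖x‖ ^ p.α) * W.iotPower ⟨0, p.N_pos⟩ j x ω)) ^ p.N ∂P := by
  rw [W.measure_fail_eq_lintegral _ _ _ hx, decodeScale_eq p hx]
  set σ := ENNReal.ofReal (p.τ * ‖x‖ ^ p.α) with hσ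
  let F : Field → (Fin p.N → Field) → ℝ≥0∞ := fun a b => ∏ i,
    (1 - expNeg (σ * disturbance p n x a (b i)))
  have hD : ∀ i, Measurable fun q : Field × (Fin p.N → Field) => disturbance p n x q.1 (q.2 i) :=
    fun i => (measurable_disturbance p n).comp (f := fun q : Field × (Fin p.N → Field) =>
      (x, q.1, q.2 i)) (by fun_prop)
  have hF : Measurable (Function.uncurry F) := Finset.measurable_prod _ fun i _ =>
    measurable_const.sub (measurable_expNeg.comp ((hD i).const_mul _))
  have hDb : ∀ a, Measurable fun b : Field => 1 - expNeg (σ * disturbance p n x a b) := fun a =>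
    measurable_const.sub (measurable_expNeg.comp (((measurable_disturbance p n).comp
      (f := fun b : Field => (x, a, b)) (by fun_prop)).const_mul _))
  change ∫⁻ ω, F (W.iotField ⟨0, p.N_pos⟩ j ω) (fun i => W.incField i j ω) ∂P = _
  rw [lintegral_comp_indepFun (W.indepFun_iotField_incFields _ j) (W.measurable_iotField _ j)
    (measurable_pi_lambda _ fun i => W.measurable_incField i j) hF]
  refine lintegral_congr fun ω => ?_
  simp only [F]
  rw [lintegral_prod_eq_prod_lintegral_of_indepFun _
    (fun i ω' => 1 - expNeg (σ * disturbance p n x (W.iotField ⟨0, p.N_pos⟩ j ω) (W.incField i j ω')))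
    ((W.iIndepFun_incField j).comp _ fun i => hDb (W.iotField ⟨0, p.N_pos⟩ j ω))
    (fun i => (hDb _).comp (W.measurable_incField i j))]
  rw [← Fin.prod_const]
  refine Finset.prod_congr rfl fun i _ => ?_
  have hJ := W.measurable_incPower i j x
  have hsplit : ∀ ω', expNeg (σ * disturbance p n x (W.iotField ⟨0, p.N_pos⟩ j ω) (W.incField i j ω'))
      = expNeg (σ * ENNReal.ofReal n) * expNeg (σ * W.iotPower ⟨0, p.N_pos⟩ j x ω) *
        expNeg (σ * ENNReal.ofReal p.PIhat * W.incPower i j x ω') := fun ω' => by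
    rw [disturbance, mul_add, mul_add, expNeg_add, expNeg_add, ← mul_assoc σ]
    rfl
  simp_rw [hsplit]
  have hle : ∀ ω', expNeg (σ * ENNReal.ofReal n) * expNeg (σ * W.iotPower ⟨0, p.N_pos⟩ j x ω) *
        expNeg (σ * ENNReal.ofReal p.PIhat * W.incPower i j x ω') ≤ 1 := fun ω' =>
    mul_le_one' (mul_le_one' (expNeg_le_one _) (expNeg_le_one _)) (expNeg_le_one _)
  rw [lintegral_sub (by fun_prop) _ (ae_of_all _ hle), lintegral_const_mul _ (by fun_prop),
    W.lintegral_expNeg_incPower i j x (ENNReal.mul_ne_top ENNReal.ofReal_ne_top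
      ENNReal.ofReal_ne_top), attenuation]
  · simp only [lintegral_const, measure_univ, mul_one]
    rw [mul_right_comm]
  · refine ne_top_of_le_ne_top ENNReal.one_ne_top ((lintegral_mono hle).trans ?_)
    simp

lemma lintegral_expNeg_disturbance (n : ℝ) (i : Fin p.N) (j : ℕ) (x : Plane) {σ : ℝ≥0∞}
    (hσ : σ ≠ ⊤) : ∫⁻ ω, expNeg (σ * disturbance p n x (W.iotField i j ω) (W.incField i j ω)) ∂P
      = attenuation p n σ * ∫⁻ ω, expNeg (σ * W.iotPower i j x ω) ∂P := by
  have hI' := W.measurable_iotPower i j x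
  have hJ' := W.measurable_incPower i j x
  have hI := measurable_expNeg.comp (hI'.const_mul σ)
  have hJ := measurable_expNeg.comp (hJ'.const_mul (σ * ENNReal.ofReal p.PIhat))
  have hsplit : ∀ ω, expNeg (σ * disturbance p n x (W.iotField i j ω) (W.incField i j ω))
      = expNeg (σ * ENNReal.ofReal n) * (expNeg (σ * W.iotPower i j x ω) *
        expNeg (σ * ENNReal.ofReal p.PIhat * W.incPower i j x ω)) := fun ω => by
    rw [disturbance, mul_add, mul_add, expNeg_add, expNeg_add, ← mul_assoc σ, mul_assoc (expNeg _)]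
    rfl
  have hind : IndepFun (expNeg ∘ fun ω => σ * W.iotPower i j x ω)
      (expNeg ∘ fun ω => σ * ENNReal.ofReal p.PIhat * W.incPower i j x ω) P :=
    (W.indepFun_iotField_incField i i j).comp
      (measurable_expNeg.comp ((measurable_fieldPower p.α x).const_mul σ))
      (measurable_expNeg.comp ((measurable_fieldPower p.α x).const_mul (σ * ENNReal.ofReal p.PIhat)))
  rw [lintegral_congr hsplit, lintegral_const_mul _ (by fun_prop)]
  have := lintegral_mul_eq_lintegral_mul_lintegral_of_indepFun hI hJ hind
  simp only [Pi.mul_apply, Function.comp_apply] at this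
  rw [this, W.lintegral_expNeg_incPower i j x (ENNReal.mul_ne_top hσ ENNReal.ofReal_ne_top),
    attenuation, mul_assoc, mul_comm (∫⁻ ω, _ ∂P)]

/-- Here the messages meet independent devices as well as independent incumbents, so the power comes
outside the average. -/
lemma lintegral_prod_random (n : ℝ) (j : ℕ) (x : Plane) {σ : ℝ≥0∞} (hσ : σ ≠ ⊤) :
    ∫⁻ ω, ∏ i : Fin p.N, (1 - expNeg (σ * disturbance p n x (W.iotField i j ω)
      (W.incField i j ω))) ∂P = (1 - attenuation p n σ *
        ∫⁻ ω, expNeg (σ * W.iotPower ⟨0, p.N_pos⟩ j x ω) ∂P) ^ p.N := by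
  have hD : Measurable fun q : Field × Field => expNeg (σ * disturbance p n x q.1 q.2) :=
    measurable_expNeg.comp (((measurable_disturbance p n).comp
      (f := fun q : Field × Field => (x, q.1, q.2)) (by fun_prop)).const_mul _)
  have hD' : Measurable fun q : Field × Field => 1 - expNeg (σ * disturbance p n x q.1 q.2) :=
    measurable_const.sub hD
  have hm : ∀ i, Measurable fun ω => (W.iotField i j ω, W.incField i j ω) := fun i =>
    (W.measurable_iotField i j).prodMk (W.measurable_incField i j)
  have hind : iIndepFun
      (fun i ω => 1 - expNeg (σ * disturbance p n x (W.iotField i j ω) (W.incField i j ω))) P :=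
    (W.iIndepFun_fields j).comp (fun _ q => 1 - expNeg (σ * disturbance p n x q.1 q.2))
      fun _ => hD'
  have hmeas : ∀ i, Measurable fun ω =>
      1 - expNeg (σ * disturbance p n x (W.iotField i j ω) (W.incField i j ω)) := fun i => by
    simpa only [Function.comp_def] using hD'.comp (hm i)
  rw [lintegral_prod_eq_prod_lintegral_of_indepFun _ _ hind hmeas, ← Fin.prod_const]
  refine Finset.prod_congr rfl fun i _ => ?_
  have hle : ∫⁻ ω, expNeg (σ * disturbance p n x (W.iotField i j ω) (W.incField i j ω)) ∂P ≤ 1 :=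
    (lintegral_mono fun ω => expNeg_le_one _).trans (by simp)
  have hDm : Measurable fun ω =>
      expNeg (σ * disturbance p n x (W.iotField i j ω) (W.incField i j ω)) := by
    simpa only [Function.comp_def] using hD.comp (hm i)
  -- The devices of message `i` may be replaced by those of message `0` because both have the same
  -- explicit Laplace transform.
  rw [lintegral_sub hDm (ne_top_of_le_ne_top ENNReal.one_ne_top hle)
    (ae_of_all _ fun ω => expNeg_le_one _), W.lintegral_expNeg_disturbance n i j x hσ,
    W.lintegral_expNeg_iotPower i j x hσ, W.lintegral_expNeg_iotPower _ j x hσ]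
  simp

lemma measure_fail_random (n : ℝ) (j : ℕ) {x : Plane} (hx : x ≠ 0) :
    P {ω | (x, W.mark j ω) ∈ failSet p .random n} =
      (1 - attenuation p n (ENNReal.ofReal (p.τ * ‖x‖ ^ p.α)) *
        ∫⁻ ω, expNeg (ENNReal.ofReal (p.τ * ‖x‖ ^ p.α) * W.iotPower ⟨0, p.N_pos⟩ j x ω) ∂P)
          ^ p.N := by
  rw [W.measure_fail_eq_lintegral _ _ _ hx, decodeScale_eq p hx,
    ← W.lintegral_prod_random n j x ENNReal.ofReal_ne_top]
  rfl

/-- At a given location, random repetition fails at most as often as PN repetition. -/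
lemma measure_fail_random_le_pn (n : ℝ) (j : ℕ) {x : Plane} (hx : x ≠ 0) :
    P {ω | (x, W.mark j ω) ∈ failSet p .random n} ≤ P {ω | (x, W.mark j ω) ∈ failSet p .pn n} := by
  rw [W.measure_fail_random n j hx, W.measure_fail_pn n j hx]
  exact one_sub_mul_lintegral_pow_le
    (measurable_expNeg.comp ((W.measurable_iotPower _ j x).const_mul _))
    (fun ω => expNeg_le_one _) (attenuation_le_one _ _ _) p.N_pos

/-- The identity `αδ = 2` turns the path loss into `r^2`, which is why Gaussian integrals appear. -/
lemma mul_rpow_δ (p : Params) {r c : ℝ} (hr : 0 ≤ r) (hc : 0 ≤ c) :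
    (p.τ * r ^ p.α * c) ^ p.δ = p.τ ^ p.δ * c ^ p.δ * r ^ 2 := by
  have h1 : 0 ≤ r ^ p.α := Real.rpow_nonneg hr _
  rw [Real.mul_rpow (mul_nonneg p.τ_pos.le h1) hc, Real.mul_rpow p.τ_pos.le h1,
    ← Real.rpow_mul hr, Params.δ, mul_div_cancel₀ _ p.α_pos.ne', Real.rpow_two]
  ring

lemma toReal_attenuation (p : Params) {n : ℝ} (hn : 0 ≤ n) {r : ℝ} (hr : 0 ≤ r) :
    (attenuation p n (ENNReal.ofReal (p.τ * r ^ p.α))).toReal =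
      Real.exp (-(Real.pi / p.ξ * p.τ ^ p.δ * (p.PIhat ^ p.δ * p.lamItilde) * r ^ 2
        + n * p.τ * r ^ p.α)) := by
  have h1 : 0 ≤ p.τ * r ^ p.α := mul_nonneg p.τ_pos.le (Real.rpow_nonneg hr _)
  have h2 : 0 ≤ p.τ * r ^ p.α * p.PIhat := mul_nonneg h1 p.PIhat_pos.le
  have h3 : 0 ≤ Real.pi / p.ξ := div_nonneg Real.pi_pos.le p.ξ_pos.le
  have h4 : 0 ≤ (p.τ * r ^ p.α * p.PIhat) ^ p.δ := Real.rpow_nonneg h2 _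
  rw [attenuation, ← ENNReal.ofReal_mul h1, ← ENNReal.ofReal_mul h1,
    ENNReal.ofReal_rpow_of_nonneg h2 p.δ_pos.le, ← ENNReal.ofReal_mul h3, ← ENNReal.ofReal.eq_1,
    ← ENNReal.ofReal_mul p.lamItilde_nonneg, ← expNeg_add,
    ← ENNReal.ofReal_add (mul_nonneg h1 hn) (mul_nonneg p.lamItilde_nonneg (mul_nonneg h3 h4)),
    toReal_expNeg ENNReal.ofReal_ne_top, ENNReal.toReal_ofReal
      (add_nonneg (mul_nonneg h1 hn) (mul_nonneg p.lamItilde_nonneg (mul_nonneg h3 h4))),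
    mul_rpow_δ p hr p.PIhat_pos.le]
  ring_nf

/-- The `k`-th power of the device factor is the same factor at scale `kσ`, which yields `k^δ` and
not `k`. -/
lemma toReal_lintegral_expNeg_iotPower (i : Fin p.N) (j : ℕ) (x : Plane) (k : ℕ) :
    (∫⁻ ω, expNeg (ENNReal.ofReal (p.τ * ‖x‖ ^ p.α) * W.iotPower i j x ω) ^ k ∂P).toReal =
      Real.exp (-(Real.pi / p.ξ * p.τ ^ p.δ * ((k : ℝ) ^ p.δ * p.lamIoTtilde) * ‖x‖ ^ 2)) := by
  have h1 : 0 ≤ p.τ * ‖x‖ ^ p.α := mul_nonneg p.τ_pos.le (Real.rpow_nonneg (norm_nonneg _) _)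
  have h2 : 0 ≤ p.τ * ‖x‖ ^ p.α * k := mul_nonneg h1 k.cast_nonneg
  have h3 : 0 ≤ Real.pi / p.ξ := div_nonneg Real.pi_pos.le p.ξ_pos.le
  have h4 : 0 ≤ (p.τ * ‖x‖ ^ p.α * k) ^ p.δ := Real.rpow_nonneg h2 _
  have : ∀ ω, expNeg (ENNReal.ofReal (p.τ * ‖x‖ ^ p.α) * W.iotPower i j x ω) ^ k
      = expNeg (ENNReal.ofReal (p.τ * ‖x‖ ^ p.α * k) * W.iotPower i j x ω) := fun ω => by
    rw [← expNeg_mul_natCast, ENNReal.ofReal_mul h1, ENNReal.ofReal_natCast, mul_right_comm]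
  simp_rw [this]
  rw [W.lintegral_expNeg_iotPower i j x ENNReal.ofReal_ne_top,
    ENNReal.ofReal_rpow_of_nonneg h2 p.δ_pos.le, ← ENNReal.ofReal_mul h3, ← ENNReal.ofReal.eq_1,
    ← ENNReal.ofReal_mul p.lamIoTtilde_nonneg, toReal_expNeg ENNReal.ofReal_ne_top,
    ENNReal.toReal_ofReal (mul_nonneg p.lamIoTtilde_nonneg (mul_nonneg h3 h4)),
    mul_rpow_δ p (norm_nonneg _) k.cast_nonneg]
  ring_nf

/-- Failure probability of a base station away from the origin. -/
theorem toReal_measure_fail (s : Repetition) {n : ℝ} (hn : 0 ≤ n) (j : ℕ) {x : Plane} (hx : x ≠ 0) :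
    (P {ω | (x, W.mark j ω) ∈ failSet p s n}).toReal = ∑ k ∈ Finset.range (p.N + 1),
      (p.N.choose k : ℝ) * (-1) ^ k * Real.exp (-p.exponent s n k ‖x‖) := by
  have hX := measurable_expNeg.comp ((W.measurable_iotPower ⟨0, p.N_pos⟩ j x).const_mul
    (ENNReal.ofReal (p.τ * ‖x‖ ^ p.α)))
  cases s with
  | pn =>
    rw [W.measure_fail_pn n j hx]
    refine (toReal_lintegral_one_sub_mul_pow hX (fun ω => expNeg_le_one _)
      (attenuation_le_one _ _ _) p.N).trans (Finset.sum_congr rfl fun k _ => ?_)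
    simp only [Function.comp_apply]
    rw [W.toReal_lintegral_expNeg_iotPower, toReal_attenuation p hn (norm_nonneg _),
      ← Real.exp_nat_mul, ← Real.exp_add, Params.exponent, Params.rate]
    ring_nf
  | random =>
    set c := ∫⁻ ω, expNeg (ENNReal.ofReal (p.τ * ‖x‖ ^ p.α) * W.iotPower ⟨0, p.N_pos⟩ j x ω) ∂P
      with hc
    have hc1 : c ≤ 1 := (lintegral_mono fun ω => expNeg_le_one _).trans (by simp)
    have h1 := W.toReal_lintegral_expNeg_iotPower ⟨0, p.N_pos⟩ j x 1
    simp only [pow_one, ← hc, Nat.cast_one, Real.one_rpow, one_mul] at h1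
    rw [W.measure_fail_random n j hx, ← hc]
    -- For a constant `X` the moments are powers of `c`, hence a rate linear in `k`.
    have h2 := toReal_lintegral_one_sub_mul_pow (P := P) (X := fun _ => c) measurable_const
      (fun _ => hc1) (attenuation_le_one p n (ENNReal.ofReal (p.τ * ‖x‖ ^ p.α))) p.N
    simp only [lintegral_const, measure_univ, mul_one] at h2
    refine h2.trans (Finset.sum_congr rfl fun k _ => ?_)
    rw [ENNReal.toReal_pow, h1, toReal_attenuation p hn (norm_nonneg _),
      ← Real.exp_nat_mul, ← Real.exp_nat_mul, ← Real.exp_add, Params.exponent, Params.rate]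
    ring_nf

end Network

end

/-! ### From one station to the whole network. -/

section

set_option synthInstance.maxSize 1000

/-- With factors in `[0, 1]` the partial products decrease along finite sets, so the unconditional
product exists and agrees with the limit along initial segments. This links `∏'` to limits of
probabilities. -/
lemma hasProd_of_tendsto_range {q : ℕ → ℝ} (h0 : ∀ j, 0 ≤ q j) (h1 : ∀ j, q j ≤ 1) {L : ℝ}
    (hL : Tendsto (fun m => ∏ j ∈ Finset.range m, q j) atTop (𝓝 L)) : HasProd q L := by
  have hanti : Antitone fun s : Finset ℕ => ∏ j ∈ s, q j := fun s t hst =>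
    Finset.prod_le_prod_of_subset_of_le_one hst (fun j _ => h0 j) fun j _ _ => h1 j
  have hbdd : BddBelow (Set.range fun s : Finset ℕ => ∏ j ∈ s, q j) :=
    ⟨0, by rintro _ ⟨s, rfl⟩; exact Finset.prod_nonneg fun j _ => h0 j⟩
  have h := tendsto_atTop_ciInf hanti hbdd
  have : HasProd q (⨅ s : Finset ℕ, ∏ j ∈ s, q j) := h
  rwa [tendsto_nhds_unique hL (h.comp tendsto_finset_range)]

/-- Induction on `N`: `C(N+1,k+1)/(k+1) = C(N,k+1)/(k+1) + C(N+1,k+1)/(N+1)`, and the alternating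
sum of the last terms is `-1/(N+1)`. -/
lemma harmonic_eq_neg_sum_choose (N : ℕ) :
    (harmonic N : ℝ) = -∑ k ∈ Finset.Icc 1 N, (N.choose k : ℝ) * (-1) ^ k * (k : ℝ)⁻¹ := by
  have hr : ∀ N : ℕ, ∑ k ∈ Finset.Icc 1 N, (N.choose k : ℝ) * (-1) ^ k * (k : ℝ)⁻¹
      = ∑ k ∈ Finset.range N, (N.choose (k + 1) : ℝ) * (-1) ^ (k + 1) * ((k : ℝ) + 1)⁻¹ := fun N => by
    rw [← Finset.Ico_add_one_right_eq_Icc, Finset.sum_Ico_eq_sum_range]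
    simp [add_comm]
  rw [hr]
  induction N with
  | zero => simp
  | succ N ih =>
    have hN : (N : ℝ) + 1 ≠ 0 := by positivity
    have h1 : ∀ k : ℕ, ((N + 1).choose (k + 1) : ℝ) * (-1) ^ (k + 1) * ((k : ℝ) + 1)⁻¹
        = (N.choose (k + 1) : ℝ) * (-1) ^ (k + 1) * ((k : ℝ) + 1)⁻¹
          + ((N : ℝ) + 1)⁻¹ * ((-1) ^ (k + 1) * ((N + 1).choose (k + 1) : ℝ)) := fun k => by
      have hk : (k : ℝ) + 1 ≠ 0 := by positivity
      have h : ((N : ℝ) + 1) * N.choose k = (N + 1).choose (k + 1) * ((k : ℝ) + 1) := by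
        exact_mod_cast Nat.add_one_mul_choose_eq N k
      have h' : ((N + 1).choose (k + 1) : ℝ) = N.choose k + N.choose (k + 1) := by
        exact_mod_cast Nat.choose_succ_succ N k
      field_simp
      linear_combination ((N : ℝ) + 1) * h' + h
    have h2 : ∑ k ∈ Finset.range (N + 1), (-1 : ℝ) ^ (k + 1) * ((N + 1).choose (k + 1) : ℝ) = -1 := by
      have h := Int.alternating_sum_range_choose_of_ne (Nat.succ_ne_zero N)
      rw [Finset.sum_range_succ'] at h
      have h' := congrArg (Int.cast : ℤ → ℝ) h
      push_cast at h'
      simp at h'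
      linarith
    simp_rw [h1]
    rw [Finset.sum_add_distrib, ← Finset.mul_sum, h2, Finset.sum_range_succ, harmonic_succ]
    push_cast
    rw [ih]
    simp
    ring

variable {Ω : Type*} [mΩ : MeasurableSpace Ω] {P : Measure Ω}

/-- The Laplace functional at the function equal to `∞` on the null set `{x}` and `0` elsewhere is
`1`, which forces the total to vanish almost surely. It excludes a station at the origin, where the
failure formula is not available. -/
lemma IsHPPP.ae_ne [IsProbabilityMeasure P] {Φ : Ω → Config} {l : ℝ≥0} (h : IsHPPP P Φ l)
    (x : Plane) : ∀ᵐ ω ∂P, ∀ j : ℕ, (j : ℕ∞) < (Φ ω).1 → (Φ ω).2 j ≠ x := by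
  have hg : Measurable (({x} : Set Plane).indicator fun _ => (⊤ : ℝ≥0∞)) :=
    measurable_const.indicator (measurableSet_singleton x)
  have h1 := h.lintegral_expNeg_total hg
  have h0 : ∫⁻ y, (1 - expNeg (({x} : Set Plane).indicator (fun _ => (⊤ : ℝ≥0∞)) y)) = 0 := by
    rw [← lintegral_zero (μ := (volume : Measure Plane))]
    refine lintegral_congr_ae ?_
    have : ∀ᵐ y : Plane, y ≠ x := by rw [ae_iff]; simp
    filter_upwards [this] with y hy
    simp [hy]
  rw [h0, mul_zero, expNeg_zero] at h1
  have hm := measurable_expNeg.comp ((measurable_total hg).comp h.measurable)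
  have h2 : (fun ω => expNeg ((Φ ω).total (({x} : Set Plane).indicator fun _ => ⊤)))
      =ᵐ[P] fun _ => 1 :=
    ae_eq_of_ae_le_of_lintegral_le (ae_of_all _ fun ω => expNeg_le_one _) (by rw [h1]; simp)
      (by fun_prop) (by rw [h1]; simp)
  filter_upwards [h2] with ω hω j hj hx
  have : (⊤ : ℝ≥0∞) ≤ (Φ ω).total (({x} : Set Plane).indicator fun _ => ⊤) := by
    have := ENNReal.le_tsum (f := fun u : {u : ℕ // (u : ℕ∞) < (Φ ω).1} =>
      ({x} : Set Plane).indicator (fun _ => (⊤ : ℝ≥0∞)) ((Φ ω).2 u)) ⟨j, hj⟩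
    rwa [Set.indicator_of_mem (Set.mem_singleton_iff.2 hx)] at this
  rw [top_le_iff] at this
  rw [this, expNeg_top] at hω
  exact zero_ne_one hω

namespace Network

variable {p : Params} (W : Network p P)

/-- Event that no base station of the configuration `c` decodes a message. -/
def allFail (s : Repetition) (n : ℝ) (c : Config) : Set Ω :=
  {ω | ∀ j : ℕ, (j : ℕ∞) < c.1 → (c.2 j, W.mark j ω) ∈ failSet p s n}

lemma measurableSet_allFail_marks (p : Params) (s : Repetition) (n : ℝ) :
    MeasurableSet {q : Config × (ℕ → Mark p.N) |
      ∀ j : ℕ, (j : ℕ∞) < q.1.1 → (q.1.2 j, q.2 j) ∈ failSet p s n} := by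
  rw [Set.ofPred_forall]
  refine MeasurableSet.iInter fun j => ?_
  have h1 : MeasurableSet {q : Config × (ℕ → Mark p.N) | (j : ℕ∞) < q.1.1} :=
    measurable_fst (measurableSet_lt_config j)
  have h2 : MeasurableSet {q : Config × (ℕ → Mark p.N) | (q.1.2 j, q.2 j) ∈ failSet p s n} :=
    (measurableSet_failSet p s n).preimage (by fun_prop)
  convert h1.compl.union h2 using 1
  ext q; simp [imp_iff_not_or]

/-- By independence of the marks, each finite product is the probability that the first `m` stations
fail; these events decrease to total failure. -/
lemma tendsto_prod_fail [IsProbabilityMeasure P] (s : Repetition) (n : ℝ) (c : Config) :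
    Tendsto (fun m => ∏ j ∈ Finset.range m, if (j : ℕ∞) < c.1 then
      P {ω | (c.2 j, W.mark j ω) ∈ failSet p s n} else 1) atTop (𝓝 (P (W.allFail s n c))) := by
  set A : ℕ → Set (Mark p.N) := fun j => {k | (j : ℕ∞) < c.1 → (c.2 j, k) ∈ failSet p s n} with hA
  have hAm : ∀ j, MeasurableSet (A j) := by
    intro j
    by_cases hj : (j : ℕ∞) < c.1
    · simp only [hA, hj, true_imp_iff]
      exact (measurableSet_failSet p s n).preimage measurable_prodMk_left
    · simp [hA, hj]
  have h1 : ∀ m, P (⋂ j ∈ Finset.range m, W.mark j ⁻¹' A j) = ∏ j ∈ Finset.range m,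
      if (j : ℕ∞) < c.1 then P {ω | (c.2 j, W.mark j ω) ∈ failSet p s n} else 1 := by
    intro m
    rw [W.iIndepFun_mark.measure_inter_preimage_eq_mul _ fun j _ => hAm j]
    refine Finset.prod_congr rfl fun j _ => ?_
    by_cases hj : (j : ℕ∞) < c.1
    · simp only [hA, hj, true_imp_iff, if_true]; rfl
    · simp [hA, hj]
  have h2 : W.allFail s n c = ⋂ m, ⋂ j ∈ Finset.range m, W.mark j ⁻¹' A j := by
    ext ω
    simp only [allFail, Set.mem_iInter, Finset.mem_range, Set.mem_preimage, hA]
    exact ⟨fun h m j _ => h j, fun h j => h (j + 1) j (Nat.lt_succ_self j)⟩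
  simp_rw [← h1]
  rw [h2]
  refine tendsto_measure_iInter_atTop (fun m => ?_) ?_ ⟨0, measure_ne_top _ _⟩
  · exact (Finset.measurableSet_biInter _ fun j _ => W.measurable_mark j (hAm j)).nullMeasurableSet
  · exact fun a b hab => Set.biInter_mono (Finset.range_mono hab) fun _ _ => subset_rfl

lemma tprod_failProb [IsProbabilityMeasure P] (s : Repetition) (n : ℝ) (c : Config) :
    ∏' j : {j : ℕ // (j : ℕ∞) < c.1}, W.failProb s n j (c.2 j) = P.real (W.allFail s n c) := by
  have h := (ENNReal.tendsto_toReal (measure_ne_top P (W.allFail s n c))).comp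
    (W.tendsto_prod_fail s n c)
  have h' : HasProd ({j : ℕ | (j : ℕ∞) < c.1}.mulIndicator fun j => W.failProb s n j (c.2 j))
      (P.real (W.allFail s n c)) := by
    refine hasProd_of_tendsto_range (fun j => ?_) (fun j => ?_) ?_
    · by_cases hj : (j : ℕ∞) < c.1
      · simp [Set.mulIndicator, hj, failProb]
      · simp [Set.mulIndicator, hj]
    · by_cases hj : (j : ℕ∞) < c.1
      · simp [Set.mulIndicator, hj, failProb, measureReal_le_one]
      · simp [Set.mulIndicator, hj]
    · rw [measureReal_def]
      convert h using 2 with m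
      simp only [Function.comp_apply, ENNReal.toReal_prod]
      refine Finset.prod_congr rfl fun j _ => ?_
      by_cases hj : (j : ℕ∞) < c.1
      · simp [Set.mulIndicator, hj, failProb_eq]
      · simp [Set.mulIndicator, hj]
  rw [← h'.tprod_eq]
  exact tprod_subtype {j : ℕ | (j : ℕ∞) < c.1} fun j => W.failProb s n j (c.2 j)

/-- Fubini for the station locations and the marks, which are independent. -/
lemma measure_fail_all [IsProbabilityMeasure P] (s : Repetition) (n : ℝ) :
    P {ω | ω ∈ W.allFail s n (W.bs ω)} = ∫⁻ ω, P (W.allFail s n (W.bs ω)) ∂P := by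
  have hm := measurableSet_allFail_marks p s n
  set A := {q : Config × (ℕ → Mark p.N) |
      ∀ j : ℕ, (j : ℕ∞) < q.1.1 → (q.1.2 j, q.2 j) ∈ failSet p s n} with hA
  have hmk : Measurable fun ω j => W.mark j ω := measurable_pi_lambda _ fun j => W.measurable_mark j
  have hF : Measurable (Function.uncurry fun (c : Config) (k : ℕ → Mark p.N) =>
      A.indicator (1 : Config × (ℕ → Mark p.N) → ℝ≥0∞) (c, k)) := measurable_one.indicator hm
  have h := lintegral_comp_indepFun W.indepFun_bs_mark W.bs_hppp.measurable hmk hF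
  have h1 : ∀ c : Config, ∫⁻ ω', A.indicator (1 : Config × (ℕ → Mark p.N) → ℝ≥0∞) (c, fun j => W.mark j ω') ∂P
      = P (W.allFail s n c) := fun c =>
    lintegral_indicator_one (hm.preimage (measurable_const.prodMk hmk))
  have h2 : ∫⁻ ω, A.indicator (1 : Config × (ℕ → Mark p.N) → ℝ≥0∞) (W.bs ω, fun j => W.mark j ω) ∂P
      = P {ω | ω ∈ W.allFail s n (W.bs ω)} :=
    lintegral_indicator_one (hm.preimage (W.bs_hppp.measurable.prodMk hmk))
  rw [← h2, h]
  simp_rw [h1]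

lemma measurable_measure_allFail [IsProbabilityMeasure P] (s : Repetition) (n : ℝ) :
    Measurable fun c => P (W.allFail s n c) := by
  have hmk : Measurable fun ω j => W.mark j ω := measurable_pi_lambda _ fun j => W.measurable_mark j
  exact measurable_measure_prodMk_left (ν := P) ((measurableSet_allFail_marks p s n).preimage
    (f := fun q : Config × Ω => (q.1, fun j => W.mark j q.2))
    (measurable_fst.prodMk (hmk.comp measurable_snd)))

lemma successProb_eq_one_sub [IsProbabilityMeasure P] (s : Repetition) (n : ℝ) :
    W.successProb s n = 1 - P.real {ω | ω ∈ W.allFail s n (W.bs ω)} := by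
  have hmk : Measurable fun ω j => W.mark j ω := measurable_pi_lambda _ fun j => W.measurable_mark j
  have hm : MeasurableSet {ω | ω ∈ W.allFail s n (W.bs ω)} :=
    (measurableSet_allFail_marks p s n).preimage (W.bs_hppp.measurable.prodMk hmk)
  rw [← probReal_compl_eq_one_sub hm, successProb]
  congr 1
  ext ω
  have hf : ω ∈ W.allFail s n (W.bs ω) ↔ ∀ j : ℕ, (j : ℕ∞) < (W.bs ω).1 →
      ∀ i, W.sinr s n i j ((W.bs ω).2 j) ω ≤ ENNReal.ofReal p.τ :=
    forall_congr' fun j => imp_congr_right fun _ =>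
      (iSup_le_iff : (⨆ i, W.sinr s n i j ((W.bs ω).2 j) ω) ≤ ENNReal.ofReal p.τ ↔ _)
  change _ ↔ ¬ (ω ∈ W.allFail s n (W.bs ω))
  rw [hf]
  simp

/-- Success probability as one minus the mean product of failure probabilities. -/
theorem successProb_eq_integral_tprod [IsProbabilityMeasure P] (s : Repetition) (n : ℝ) :
    W.successProb s n = 1 - ∫ ω, ∏' j : {j : ℕ // (j : ℕ∞) < (W.bs ω).1},
        W.failProb s n j ((W.bs ω).2 j) ∂P := by
  simp_rw [W.tprod_failProb]
  rw [successProb_eq_one_sub, measureReal_def, measure_fail_all]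
  congr 1
  exact (integral_toReal ((W.measurable_measure_allFail s n).comp W.bs_hppp.measurable).aemeasurable
    (ae_of_all _ fun ω => measure_lt_top _ _)).symm

/-- The failure probability seen by a base station at `x`. -/
def failAt (s : Repetition) (n : ℝ) (x : Plane) : ℝ≥0∞ := P {ω | (x, W.mark 0 ω) ∈ failSet p s n}

lemma measurable_failAt [IsProbabilityMeasure P] (s : Repetition) (n : ℝ) :
    Measurable (W.failAt s n) :=
  measurable_measure_prodMk_left ((measurableSet_failSet p s n).preimage
    (measurable_fst.prodMk ((W.measurable_mark 0).comp measurable_snd)))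

theorem successProb_eq_expNeg [IsProbabilityMeasure P] (s : Repetition) {n : ℝ} (hn : 0 ≤ n) :
    W.successProb s n
      = 1 - (expNeg (p.lamB.toNNReal * ∫⁻ x, (1 - W.failAt s n x))).toReal := by
  have hle : ∀ x, W.failAt s n x ≤ 1 := fun x => prob_le_one
  have hm := W.measurable_failAt s n
  have h := W.bs_hppp.lintegral_expNeg_total (measurable_negLog.comp hm)
  simp only [Function.comp_apply, expNeg_negLog (hle _)] at h
  rw [successProb_eq_one_sub, measureReal_def, measure_fail_all, ← h]
  congr 2
  refine lintegral_congr_ae ?_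
  filter_upwards [W.bs_hppp.ae_ne 0] with ω hω
  refine tendsto_nhds_unique (W.tendsto_prod_fail s n (W.bs ω)) ?_
  rw [Config.total_eq]
  convert tendsto_prod_expNeg _ using 2 with m
  refine Finset.prod_congr rfl fun j _ => ?_
  split_ifs with hj
  -- `failAt` is built from the mark of station `0`; the explicit failure formula does not involve
  -- the station index, so it serves every station off the origin.
  · rw [Function.comp_apply, expNeg_negLog (hle _), failAt,
      ← ENNReal.toReal_eq_toReal_iff' (measure_ne_top _ _) (measure_ne_top _ _),
      W.toReal_measure_fail s hn _ (hω j hj), W.toReal_measure_fail s hn _ (hω j hj)]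
  · simp

/-- PN repetition does no better than random repetition. -/
theorem successProb_pn_le_random [IsProbabilityMeasure P] {n : ℝ} (hn : 0 ≤ n) :
    W.successProb .pn n ≤ W.successProb .random n := by
  rw [W.successProb_eq_expNeg _ hn, W.successProb_eq_expNeg _ hn]
  refine sub_le_sub_left (ENNReal.toReal_mono (expNeg_ne_top _) (expNeg_antitone ?_)) _
  refine mul_le_mul_right (lintegral_mono_ae ?_) _
  have : ∀ᵐ y : Plane, y ≠ 0 := by rw [ae_iff]; simp
  filter_upwards [this] with x hx
  exact tsub_le_tsub_left (W.measure_fail_random_le_pn n 0 hx) _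

end Network

/-! ### Integration over the station location and the closed forms. -/

section ClosedForms

variable (p : Params)

lemma exponent_zero (s : Repetition) (n r : ℝ) : p.exponent s n 0 r = 0 := by
  simp [Params.exponent, p.rate_zero]

lemma coeff_pos (s : Repetition) {k : ℕ} (hk : 0 < k) :
    0 < Real.pi / p.ξ * p.τ ^ p.δ * p.rate s k := by
  have := p.ξ_pos
  have := Real.rpow_pos_of_pos p.τ_pos p.δ
  have := p.rate_pos s hk
  positivity

/-- Dropping the noise gives a bound independent of `n`, a Gaussian that dominates in the limit `n →
0⁺`. -/
lemma exp_neg_exponent_le (s : Repetition) {n : ℝ} (hn : 0 ≤ n) (k : ℕ) (x : Plane) :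
    Real.exp (-p.exponent s n k ‖x‖)
      ≤ Real.exp (-(Real.pi / p.ξ * p.τ ^ p.δ * p.rate s k) * ‖x‖ ^ 2) := by
  have h : 0 ≤ k * n * p.τ * ‖x‖ ^ p.α :=
    mul_nonneg (mul_nonneg (by positivity) p.τ_pos.le) (Real.rpow_nonneg (norm_nonneg _) _)
  refine Real.exp_le_exp.2 ?_
  rw [Params.exponent]
  linarith

lemma integrable_gaussian {b : ℝ} (hb : 0 < b) :
    Integrable fun x : Plane => Real.exp (-b * ‖x‖ ^ 2) := by
  refine Integrable.of_integral_ne_zero ?_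
  rw [GaussianFourier.integral_rexp_neg_mul_sq_norm hb]
  positivity

lemma continuous_exp_neg_exponent (s : Repetition) (n : ℝ) (k : ℕ) :
    Continuous fun x : Plane => Real.exp (-p.exponent s n k ‖x‖) := by
  unfold Params.exponent
  have : Continuous fun x : Plane => ‖x‖ ^ p.α :=
    continuous_norm.rpow_const fun _ => Or.inr p.α_pos.le
  fun_prop

lemma integrable_exp_neg_exponent (s : Repetition) {n : ℝ} (hn : 0 ≤ n) {k : ℕ} (hk : 0 < k) :
    Integrable fun x : Plane => Real.exp (-p.exponent s n k ‖x‖) := by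
  refine (integrable_gaussian (coeff_pos p s hk)).mono'
    (continuous_exp_neg_exponent p s n k).aestronglyMeasurable (ae_of_all _ fun x => ?_)
  rw [Real.norm_of_nonneg (Real.exp_pos _).le]
  exact exp_neg_exponent_le p s hn k x

lemma integral_exp_neg_exponent_zero (s : Repetition) {k : ℕ} (hk : 0 < k) :
    ∫ x : Plane, Real.exp (-p.exponent s 0 k ‖x‖) = p.ξ * p.τ ^ (-p.δ) / p.rate s k := by
  have h : ∀ x : Plane, Real.exp (-p.exponent s 0 k ‖x‖)
      = Real.exp (-(Real.pi / p.ξ * p.τ ^ p.δ * p.rate s k) * ‖x‖ ^ 2) := fun x => by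
    simp [Params.exponent]
  simp_rw [h]
  rw [GaussianFourier.integral_rexp_neg_mul_sq_norm (coeff_pos p s hk), finrank_euclideanSpace,
    Fintype.card_fin, Nat.cast_ofNat, div_self two_ne_zero, Real.rpow_one, Real.rpow_neg p.τ_pos.le]
  have := p.ξ_pos
  have := Real.rpow_pos_of_pos p.τ_pos p.δ
  have := p.rate_pos s hk
  field_simp

lemma tendsto_integral_exp_neg_exponent (s : Repetition) {k : ℕ} (hk : 0 < k) :
    Tendsto (fun n => ∫ x : Plane, Real.exp (-p.exponent s n k ‖x‖)) (𝓝[>] 0)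
      (𝓝 (∫ x : Plane, Real.exp (-p.exponent s 0 k ‖x‖))) := by
  refine tendsto_integral_filter_of_dominated_convergence
    (fun x : Plane => Real.exp (-(Real.pi / p.ξ * p.τ ^ p.δ * p.rate s k) * ‖x‖ ^ 2))
    (Eventually.of_forall fun n => (continuous_exp_neg_exponent p s n k).aestronglyMeasurable) ?_
    (integrable_gaussian (coeff_pos p s hk)) (ae_of_all _ fun x => ?_)
  · filter_upwards [self_mem_nhdsWithin] with n hn
    refine ae_of_all _ fun x => ?_
    rw [Real.norm_of_nonneg (Real.exp_pos _).le]
    exact exp_neg_exponent_le p s (le_of_lt hn) k x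
  · have : Continuous fun n => Real.exp (-p.exponent s n k ‖x‖) := by
      unfold Params.exponent
      fun_prop
    exact (this.tendsto 0).mono_left nhdsWithin_le_nhds

/-- Alternating sum of the probabilities that given messages are all decoded, integrated over the
location of the base station. -/
def decodeIntegral (s : Repetition) (n : ℝ) : ℝ :=
  ∑ k ∈ Finset.Icc 1 p.N, (p.N.choose k : ℝ) * (-1) ^ k *
    ∫ x : Plane, Real.exp (-p.exponent s n k ‖x‖)

lemma tendsto_decodeIntegral (s : Repetition) :
    Tendsto (fun n => decodeIntegral p s n) (𝓝[>] 0) (𝓝 (decodeIntegral p s 0)) :=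
  tendsto_finsetSum _ fun _ hk => (tendsto_integral_exp_neg_exponent p s
    (Finset.mem_Icc.1 hk).1).const_mul _

variable {p} (W : Network p P)

theorem successProb_eq_exp [IsProbabilityMeasure P] (s : Repetition) {n : ℝ} (hn : 0 ≤ n) :
    W.successProb s n = 1 - Real.exp (p.lamB * decodeIntegral p s n) := by
  have hint : ∀ k ∈ Finset.Icc 1 p.N, Integrable (fun x : Plane => (p.N.choose k : ℝ) * (-1) ^ k *
      Real.exp (-p.exponent s n k ‖x‖)) := fun k hk =>
    (integrable_exp_neg_exponent p s hn (Finset.mem_Icc.1 hk).1).const_mul _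
  -- The `k = 0` term of the expansion is the constant `1`, not integrable over the plane; it is
  -- cancelled before integrating term by term.
  have hae : ∀ᵐ x : Plane, (W.failAt s n x).toReal - 1 = ∑ k ∈ Finset.Icc 1 p.N,
      (p.N.choose k : ℝ) * (-1) ^ k * Real.exp (-p.exponent s n k ‖x‖) := by
    have : ∀ᵐ y : Plane, y ≠ 0 := by rw [ae_iff]; simp
    filter_upwards [this] with x hx
    rw [Network.failAt, W.toReal_measure_fail s hn 0 hx, Finset.range_eq_Ico,
      Finset.sum_eq_sum_Ico_succ_bot p.N.succ_pos, Nat.succ_eq_add_one, zero_add,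
      Finset.Ico_add_one_right_eq_Icc, exponent_zero]
    simp
  have hD : decodeIntegral p s n = ∫ x, ((W.failAt s n x).toReal - 1) := by
    rw [integral_congr_ae hae, integral_finsetSum _ hint]
    simp_rw [integral_const_mul]
    rfl
  have hI : Integrable fun x => (W.failAt s n x).toReal - 1 :=
    (integrable_finsetSum _ hint).congr (hae.mono fun x hx => hx.symm)
  have hle : ∀ x, (W.failAt s n x).toReal ≤ 1 := fun x =>
    ENNReal.toReal_le_of_le_ofReal zero_le_one (by rw [ENNReal.ofReal_one]; exact prob_le_one)
  have hlin : ∫⁻ x, (1 - W.failAt s n x) = ENNReal.ofReal (-decodeIntegral p s n) := by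
    have h := ofReal_integral_eq_lintegral_ofReal hI.neg (ae_of_all _ fun x => by simpa using hle x)
    simp only [Pi.neg_apply] at h
    rw [hD, ← integral_neg, h]
    refine lintegral_congr fun x => ?_
    rw [neg_sub, ENNReal.ofReal_sub _ ENNReal.toReal_nonneg, ENNReal.ofReal_one,
      ENNReal.ofReal_toReal (show W.failAt s n x ≠ ⊤ from measure_ne_top _ _)]
  have hneg : 0 ≤ -decodeIntegral p s n := by
    rw [hD, ← integral_neg]
    exact integral_nonneg fun x => by simpa using hle x
  rw [W.successProb_eq_expNeg s hn, hlin, ← ENNReal.ofReal.eq_1, ← ENNReal.ofReal_mul p.lamB_nonneg,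
    expNeg_ofReal (mul_nonneg p.lamB_nonneg hneg), ENNReal.toReal_ofReal (Real.exp_pos _).le,
    mul_neg, neg_neg]

lemma one_sub_exp_decodeIntegral_pn :
    1 - Real.exp (p.lamB * decodeIntegral p .pn 0) = closedPN p := by
  rw [closedPN, decodeIntegral, Finset.mul_sum, Finset.mul_sum]
  congr 2
  refine Finset.sum_congr rfl fun k hk => ?_
  rw [integral_exp_neg_exponent_zero p _ (Finset.mem_Icc.1 hk).1, Params.rate]
  ring

/-- The random rate at `k` is `k` times its value at `1`, so the sum reduces to the alternating form
of the harmonic number. -/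
lemma one_sub_exp_decodeIntegral_random :
    1 - Real.exp (p.lamB * decodeIntegral p .random 0) = closedRandom p := by
  rw [closedRandom, decodeIntegral, harmonic_eq_neg_sum_choose, Finset.mul_sum, mul_neg, neg_mul,
    neg_neg, Finset.mul_sum, Finset.sum_mul]
  congr 2
  refine Finset.sum_congr rfl fun k hk => ?_
  rw [integral_exp_neg_exponent_zero p _ (Finset.mem_Icc.1 hk).1, Params.rate]
  have := p.rate_pos .random one_pos
  simp only [Params.rate, Nat.cast_one, one_mul] at this
  have hk : (k : ℝ) ≠ 0 := by have := (Finset.mem_Icc.1 hk).1; positivity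
  field_simp

theorem tendsto_successProb [IsProbabilityMeasure P] (s : Repetition) :
    Tendsto (fun n => W.successProb s n) (𝓝[>] 0)
      (𝓝 (1 - Real.exp (p.lamB * decodeIntegral p s 0))) := by
  have h := ((tendsto_decodeIntegral p s).const_mul p.lamB).rexp.const_sub 1
  refine h.congr' ?_
  filter_upwards [self_mem_nhdsWithin] with n hn
  exact (successProb_eq_exp W s (le_of_lt hn)).symm

end ClosedForms

end

end UNB

end

theorem theorem1 (p : UNB.Params) {Ω : Type*} [MeasurableSpace Ω] (P : MeasureTheory.Measure Ω)
    [MeasureTheory.IsProbabilityMeasure P] (W : UNB.Network p P) :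
    -- the success probability is one minus the mean, over the base stations, of the product of
    -- the failure probabilities
    (∀ (s : UNB.Repetition) (n : ℝ), 0 ≤ n →
      W.successProb s n = 1 - ∫ ω, ∏' j : {j : ℕ // (j : ℕ∞) < (W.bs ω).1},
        W.failProb s n j ((W.bs ω).2 j) ∂P) ∧
    -- PN repetition
    (Filter.Tendsto (fun n => W.successProb .pn n) (nhdsWithin 0 (Set.Ioi 0))
        (nhds (UNB.closedPN p)) ∧
      W.successProb .pn 0 = UNB.closedPN p) ∧
    -- random repetition
    (Filter.Tendsto (fun n => W.successProb .random n) (nhdsWithin 0 (Set.Ioi 0))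
        (nhds (UNB.closedRandom p)) ∧
      W.successProb .random 0 = UNB.closedRandom p ∧
      (harmonic p.N : ℝ)
        = -∑ k ∈ Finset.Icc 1 p.N, (p.N.choose k : ℝ) * (-1) ^ k * (k : ℝ)⁻¹) ∧
    -- PN repetition does no better than random repetition, whatever the noise
    (∀ n : ℝ, 0 ≤ n → W.successProb .pn n ≤ W.successProb .random n) := by
  refine ⟨fun s n _ => W.successProb_eq_integral_tprod s n, ⟨?_, ?_⟩, ⟨?_, ?_, ?_⟩, fun n hn =>
    W.successProb_pn_le_random hn⟩
  · exact UNB.one_sub_exp_decodeIntegral_pn ▸ UNB.tendsto_successProb W .pn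
  · exact (UNB.successProb_eq_exp W .pn le_rfl).trans UNB.one_sub_exp_decodeIntegral_pn
  · exact UNB.one_sub_exp_decodeIntegral_random ▸ UNB.tendsto_successProb W .random
  · exact (UNB.successProb_eq_exp W .random le_rfl).trans UNB.one_sub_exp_decodeIntegral_random
  · exact UNB.harmonic_eq_neg_sum_choose p.N
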